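/- **Setting.** Let $A$ be a small category. A *module* $M : A \nrightarrow A$ is a functor $M : A^{\mathrm{op}} \times A \to \mathbf{Set}$; write $m : b \nrightarrow a$ for $m \in M(b,a)$, and $fm$, $mg$ for the actions of maps $f : a \to a'$, $g : b' \to b$ of $A$. For $X : A \to \mathbf{Set}$ and $Y : A^{\mathrm{op}} \to \mathbf{Set}$ let $Y \otimes X = \int^{a} Y a \times X a = \big(\sum_a Ya \times Xa\big)/\!\sim$, where $\sim$ is generated by $(yg, x) \sim (y, gx)$. The functor $X$ is *nondegenerate* if $- \otimes X : [A^{\mathrm{op}}, \mathbf{Set}] \to \mathbf{Set}$ preserves limits over finite connected categories. A functor $X : A \to \mathbf{Top}$ is *nondegenerate* if its underlying functor to $\mathbf{Set}$ is nondegenerate and each map $Xf$ is closed. The module $M$ is *nondegenerate* if each $M(b,-)$ is, and *finite* if for each $a$ there are only finitely many diagrams $b' \to b \nrightarrow a$. A *self-similarity system* is a small category $A$ with a finite nondegenerate module $M : A \nrightarrow A$. For $X : A \to \mathbf{Top}$ put $(M \otimes X)a = \int^b M(b,a) \times Xb$, the coend being taken in $\mathbf{Top}$ with each $M(b,a)$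 discrete. An *$M$-coalgebra in $\mathbf{Top}$* is a nondegenerate functor $X : A \to \mathbf{Top}$ with a natural transformation $X \to M \otimes X$; maps of coalgebras are the natural transformations compatible with these structures. *Condition S* on $(A, M)$ consists of: - (S1) given infinite sequences $\cdots \nrightarrow a_1 \nrightarrow a_0$, $\cdots \nrightarrow b_1 \nrightarrow b_0$, $\cdots \nrightarrow a'_1 \nrightarrow a'_0$ with module elements $m_n : a_n \nrightarrow a_{n-1}$, $p_n : b_n \nrightarrow b_{n-1}$, $m'_n : a'_n \nrightarrow a'_{n-1}$ $(n \ge 1)$, and maps $f_n : a_n \to b_n$, $f'_n : a'_n \to b_n$ $(n \ge 0)$ with $f_{n-1} m_n = p_n f_n$ and $f'_{n-1} m'_n = p_n f'_n$ for all $n \ge 1$, there exist maps $g : c \to a_0$ and $g' : c \to a'_0$ in $A$ with $f_0 g = f'_0 g'$; - (S2) given infinite sequences $(a_n, m_n)$, $(b_n, p_n)$ as above and maps $f_n, f'_n : a_n \to b_n$ $(n \ge 0)$ with $f_{n-1} m_n = p_n f_n$ and $f'_{n-1} m_n = p_n f'_n$ for all $n \ge 1$, there exists a map $g : c \to a_0$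 in $A$ with $f_0 g = f'_0 g$. For $a \in A$ let $\mathcal{I}a$ be the category whose objects are the infinite sequences $\cdots \overset{m_2}{\nrightarrow} a_1 \overset{m_1}{\nrightarrow} a_0 = a$ and whose maps $(a_\bullet, m_\bullet) \to (a'_\bullet, m'_\bullet)$ are the families $f_n : a_n \to a'_n$ with $f_0 = 1_a$ and $f_{n-1} m_n = m'_n f_n$ for all $n \ge 1$. Let $Ia$ be the set of connected components of $\mathcal{I}a$, and write $[\,\cdot\,]$ for the component of an object. A map $f : a \to a'$ of $A$ induces $If : Ia \to Ia'$, replacing $m_1$ by $f m_1$; this makes $I$ a functor $A \to \mathbf{Set}$. Let $\iota_a : Ia \to (M \otimes I)a$ be the map $[\cdots \overset{m_2}{\nrightarrow} a_1 \overset{m_1}{\nrightarrow} a] \mapsto m_1 \otimes [\cdots \overset{m_2}{\nrightarrow} a_1]$, and for $q : d \nrightarrow c$ let $\phi_q : Id \to Ic$ be the map $[\cdots \nrightarrow d_1 \nrightarrow d] \mapsto [\cdots \nrightarrow d_1 \nrightarrow d \overset{q}{\nrightarrow} c]$. Give each $Ia$ the topology generated by declaring closed all the sets $\phi_{p_1}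 \cdots \phi_{p_n}(I b_n)$ with $n \ge 0$ and $b_n \overset{p_n}{\nrightarrow} \cdots \overset{p_1}{\nrightarrow} b_0 = a$. **Theorem (universal solution in $\mathbf{Top}$).** Let $(A, M)$ be a self-similarity system satisfying condition S. Then each space $Ia$ is compact Hausdorff; each map $If$ is continuous and closed; each map $\iota_a : Ia \to (M \otimes I)a$ is continuous; the resulting functor $I : A \to \mathbf{Top}$ is nondegenerate, so that $(I, \iota)$ is an $M$-coalgebra in $\mathbf{Top}$; and $(I, \iota)$ is a terminal object of the category of $M$-coalgebras in $\mathbf{Top}$. -/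

import Mathlib

open CategoryTheory CategoryTheory.Limits Opposite

universe u

namespace SelfSim

section Tensor

variable {A : Type u} [SmallCategory A]

/-- A generator of `Y ⊗ X`: an object `a`, an element of `Y a`, and an element of `X a`.  This is
the sum, over all pairs `(a, y)` with `y ∈ Y a`, of the sets `X a`. -/
abbrev PreTensor (Y : Aᵒᵖ ⥤ Type u) (X : A ⥤ Type u) : Type u :=
  Σ p : (Σ a : A, Y.obj (op a)), X.obj p.1

/-- The generating identifications `(y g, x) ∼ (y, g x)`. -/
inductive TensorRel (Y : Aᵒᵖ ⥤ Type u) (X : A ⥤ Type u) :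
    PreTensor Y X → PreTensor Y X → Prop
  | glue {a' a : A} (g : a' ⟶ a) (y : Y.obj (op a)) (x : X.obj a') :
      TensorRel Y X ⟨⟨a', Y.map g.op y⟩, x⟩ ⟨⟨a, y⟩, X.map g x⟩

/-- The set `Y ⊗ X = ∫^a Y a × X a`: the quotient of the sum by the equivalence relation generated
by `(y g, x) ∼ (y, g x)`. -/
def Tensor (Y : Aᵒᵖ ⥤ Type u) (X : A ⥤ Type u) : Type u :=
  Quot (TensorRel Y X)

/-- The element `y ⊗ x`. -/
def tmul (Y : Aᵒᵖ ⥤ Type u) (X : A ⥤ Type u) {a : A} (y : Y.obj (op a)) (x : X.obj a) :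
    Tensor Y X :=
  Quot.mk _ ⟨⟨a, y⟩, x⟩

theorem tmul_glue (Y : Aᵒᵖ ⥤ Type u) (X : A ⥤ Type u) {a' a : A} (g : a' ⟶ a)
    (y : Y.obj (op a)) (x : X.obj a') :
    tmul Y X (Y.map g.op y) x = tmul Y X y (X.map g x) :=
  Quot.sound (TensorRel.glue g y x)

/-- On generators, `(y, x) ↦ (α y, β x)`. -/
def preTensorMap {Y Y' : Aᵒᵖ ⥤ Type u} {X X' : A ⥤ Type u} (α : Y ⟶ Y') (β : X ⟶ X')
    (p : PreTensor Y X) : PreTensor Y' X' :=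
  ⟨⟨p.1.1, α.app (op p.1.1) p.1.2⟩, β.app p.1.1 p.2⟩

/-- The map `y ⊗ x ↦ α y ⊗ β x`. -/
def tensorMap {Y Y' : Aᵒᵖ ⥤ Type u} {X X' : A ⥤ Type u} (α : Y ⟶ Y') (β : X ⟶ X') :
    Tensor Y X → Tensor Y' X' :=
  Quot.lift (fun p => Quot.mk _ (preTensorMap α β p)) (by
    rintro _ _ ⟨g, y, x⟩
    have h := tmul_glue Y' X' g (α.app _ y) (β.app _ x)
    rw [← NatTrans.naturality_apply, ← NatTrans.naturality_apply] at h
    exact h)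

theorem tensorMap_tmul {Y Y' : Aᵒᵖ ⥤ Type u} {X X' : A ⥤ Type u} (α : Y ⟶ Y') (β : X ⟶ X')
    {a : A} (y : Y.obj (op a)) (x : X.obj a) :
    tensorMap α β (tmul Y X y x) = tmul Y' X' (α.app _ y) (β.app _ x) :=
  rfl

theorem tensorMap_id (Y : Aᵒᵖ ⥤ Type u) (X : A ⥤ Type u) (t : Tensor Y X) :
    tensorMap (𝟙 Y) (𝟙 X) t = t := by
  induction t using Quot.ind
  rfl

theorem tensorMap_comp {Y Y' Y'' : Aᵒᵖ ⥤ Type u} {X X' X'' : A ⥤ Type u}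
    (α : Y ⟶ Y') (α' : Y' ⟶ Y'') (β : X ⟶ X') (β' : X' ⟶ X'') (t : Tensor Y X) :
    tensorMap (α ≫ α') (β ≫ β') t = tensorMap α' β' (tensorMap α β t) := by
  induction t using Quot.ind
  rfl

/-- The functor `- ⊗ X` from presheaves on `A` to sets. -/
def tensorWith (X : A ⥤ Type u) : (Aᵒᵖ ⥤ Type u) ⥤ Type u where
  obj Y := Tensor Y X
  map α := ↾(tensorMap α (𝟙 X))
  map_id Y := by
    ext t
    exact tensorMap_id Y X t
  map_comp α α' := by
    ext t
    exact tensorMap_comp α α' (𝟙 X) (𝟙 X) t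

/-- A functor `X : A ⥤ Set` is nondegenerate (componentwise flat) when `- ⊗ X` preserves limits
over finite connected categories. -/
def Nondegenerate (X : A ⥤ Type u) : Prop :=
  ∀ (J : Type) [SmallCategory J] [FinCategory J] [IsConnected J],
    PreservesLimitsOfShape J (tensorWith X)

/-- When each `X a` is a topological space, `Y ⊗ X` carries the colimit topology, namely the
quotient of the sum topology (each set `Y a` being discrete). -/
instance tensorTopology (Y : Aᵒᵖ ⥤ Type u) (X : A ⥤ Type u)
    [∀ a, TopologicalSpace (X.obj a)] : TopologicalSpace (Tensor Y X) :=
  inferInstanceAs (TopologicalSpace (Quot (TensorRel Y X)))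

theorem continuous_tensorMap {Y Y' : Aᵒᵖ ⥤ Type u} {X X' : A ⥤ Type u}
    [∀ a, TopologicalSpace (X.obj a)] [∀ a, TopologicalSpace (X'.obj a)]
    (α : Y ⟶ Y') (β : X ⟶ X') (hβ : ∀ a, Continuous (β.app a)) :
    Continuous (tensorMap α β) := by
  refine continuous_quot_lift _ (continuous_quot_mk.comp ?_)
  refine continuous_sigma fun p => ?_
  exact (continuous_sigmaMk (σ := fun q : (Σ a : A, Y'.obj (op a)) => X'.obj q.1)
    (i := ⟨p.1, α.app (op p.1) p.2⟩)).comp (hβ p.1)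

end Tensor

section Modules

variable {A : Type u} [SmallCategory A]

/-- A module `A ⇸ A`: a functor `Aᵒᵖ × A ⥤ Set`, in curried form. -/
abbrev CatModule (A : Type u) [SmallCategory A] : Type (u + 1) := Aᵒᵖ ⥤ A ⥤ Type u

/-- The set `M(b, a)` of module elements `m : b ⇸ a`. -/
abbrev Elt (M : CatModule A) (b a : A) : Type u := (M.obj (op b)).obj a

/-- The left action: `f m : b ⇸ a'` for `m : b ⇸ a` and `f : a ⟶ a'`. -/
def lact (M : CatModule A) {b a a' : A} (f : a ⟶ a') (m : Elt M b a) : Elt M b a' :=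
  (M.obj (op b)).map f m

/-- The right action: `m g : b' ⇸ a` for `g : b' ⟶ b` and `m : b ⇸ a`. -/
def ract (M : CatModule A) {b' b a : A} (m : Elt M b a) (g : b' ⟶ b) : Elt M b' a :=
  (M.map g.op).app a m

theorem lact_id (M : CatModule A) {b a : A} (m : Elt M b a) : lact M (𝟙 a) m = m := by
  simp [lact]

theorem lact_comp (M : CatModule A) {b a a' a'' : A} (f : a ⟶ a') (f' : a' ⟶ a'') (m : Elt M b a) :
    lact M (f ≫ f') m = lact M f' (lact M f m) := by
  simp [lact]

theorem ract_id (M : CatModule A) {b a : A} (m : Elt M b a) : ract M m (𝟙 b) = m := by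
  simp [ract]

theorem ract_comp (M : CatModule A) {b'' b' b a : A} (m : Elt M b a) (g : b' ⟶ b) (g' : b'' ⟶ b') :
    ract M m (g' ≫ g) = ract M (ract M m g) g' := by
  simp [ract]

theorem lact_ract (M : CatModule A) {b' b a a' : A} (m : Elt M b a) (g : b' ⟶ b) (f : a ⟶ a') :
    ract M (lact M f m) g = lact M f (ract M m g) :=
  NatTrans.naturality_apply (M.map g.op) f m

/-- The presheaf `M(-, a)`. -/
abbrev colPresheaf (M : CatModule A) (a : A) : Aᵒᵖ ⥤ Type u := M.flip.obj a

/-- `M` is nondegenerate when each functor `M(b, -)` is. -/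
def CatModule.IsNondegenerate (M : CatModule A) : Prop := ∀ b : A, Nondegenerate (M.obj (op b))

/-- `M` is finite when for each `a` the category of elements of `M(-, a)` is finite: there are only
finitely many diagrams `b' ⟶ b ⇸ a`. -/
def CatModule.IsFinite (M : CatModule A) : Prop :=
  ∀ a : A, Finite (Σ (b' : A) (b : A), (b' ⟶ b) × Elt M b a)

/-- A self-similarity system is a small category with a finite nondegenerate module on it. -/
structure IsSelfSimilaritySystem (M : CatModule A) : Prop where
  finite : M.IsFinite
  nondegenerate : M.IsNondegenerate

/-- The solvability condition. -/
structure ConditionS (M : CatModule A) : Prop where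
  /-- For any two infinite ladders with a common codomain row, the two rightmost vertical arrows
  complete to a commutative square. -/
  square : ∀ (a b a' : ℕ → A) (m : ∀ n, Elt M (a (n + 1)) (a n))
    (p : ∀ n, Elt M (b (n + 1)) (b n)) (m' : ∀ n, Elt M (a' (n + 1)) (a' n))
    (f : ∀ n, a n ⟶ b n) (f' : ∀ n, a' n ⟶ b n),
    (∀ n, lact M (f n) (m n) = ract M (p n) (f (n + 1))) →
    (∀ n, lact M (f' n) (m' n) = ract M (p n) (f' (n + 1))) →
    ∃ (c : A) (g : c ⟶ a 0) (g' : c ⟶ a' 0), g ≫ f 0 = g' ≫ f' 0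
  /-- For any two infinite ladders with the same domain and codomain rows, the two rightmost
  vertical arrows complete to a fork. -/
  fork : ∀ (a b : ℕ → A) (m : ∀ n, Elt M (a (n + 1)) (a n))
    (p : ∀ n, Elt M (b (n + 1)) (b n)) (f f' : ∀ n, a n ⟶ b n),
    (∀ n, lact M (f n) (m n) = ract M (p n) (f (n + 1))) →
    (∀ n, lact M (f' n) (m n) = ract M (p n) (f' (n + 1))) →
    ∃ (c : A) (g : c ⟶ a 0), g ≫ f 0 = g ≫ f' 0

end Modules

section Coalgebras

variable {A : Type u} [SmallCategory A]

instance topologicalSpaceObj (X : A ⥤ TopCat.{u}) (a : A) :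
    TopologicalSpace ((X ⋙ forget TopCat.{u}).obj a) :=
  inferInstanceAs (TopologicalSpace (X.obj a))

/-- The functor `M ⊗ X : A ⥤ Top`, `(M ⊗ X) a = ∫^b M(b, a) × X b`. -/
def moduleTensor (M : CatModule A) (X : A ⥤ TopCat.{u}) : A ⥤ TopCat.{u} where
  obj a := TopCat.of (Tensor (colPresheaf M a) (X ⋙ forget TopCat.{u}))
  map f := TopCat.ofHom
    ⟨tensorMap (M.flip.map f) (𝟙 (X ⋙ forget TopCat.{u})),
      continuous_tensorMap _ _ fun _ => continuous_id⟩
  map_id a := by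
    ext t
    change tensorMap _ _ t = t
    rw [CategoryTheory.Functor.map_id]
    exact tensorMap_id _ _ t
  map_comp f g := by
    ext t
    change tensorMap _ _ t = tensorMap _ _ (tensorMap _ _ t)
    rw [CategoryTheory.Functor.map_comp]
    exact tensorMap_comp _ _ (𝟙 _) (𝟙 _) t

/-- The endofunctor `M ⊗ -` of the functor category `[A, Top]`. -/
def moduleTensorFunctor (M : CatModule A) : (A ⥤ TopCat.{u}) ⥤ (A ⥤ TopCat.{u}) where
  obj X := moduleTensor M X
  map {X X'} β :=
    { app := fun a => TopCat.ofHom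
        ⟨tensorMap (𝟙 (colPresheaf M a)) (Functor.whiskerRight β (forget TopCat.{u})),
          continuous_tensorMap _ _ fun b => (β.app b).hom.continuous⟩
      naturality := fun a a' f => by
        ext t
        change tensorMap (𝟙 _) (Functor.whiskerRight β _) (tensorMap (M.flip.map f) (𝟙 _) t) =
          tensorMap (M.flip.map f) (𝟙 _) (tensorMap (𝟙 _) (Functor.whiskerRight β _) t)
        refine (tensorMap_comp _ _ _ _ t).symm.trans (Eq.trans ?_ (tensorMap_comp _ _ _ _ t))
        rw [Category.comp_id, Category.id_comp, Category.comp_id, Category.id_comp] }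
  map_id X := by
    ext a t
    exact tensorMap_id _ _ t
  map_comp {X X' X''} β β' := by
    ext a t
    exact tensorMap_comp (𝟙 (colPresheaf M a)) (𝟙 _)
      (Functor.whiskerRight β (forget TopCat.{u})) (Functor.whiskerRight β' (forget TopCat.{u})) t

/-- A functor `X : A ⥤ Top` is nondegenerate when its underlying set-valued functor is and each
`X f` is a closed map. -/
def NondegenerateTop : ObjectProperty (A ⥤ TopCat.{u}) := fun X =>
  Nondegenerate (X ⋙ forget TopCat.{u}) ∧
    ∀ ⦃a a' : A⦄ (f : a ⟶ a'), IsClosedMap (X.map f)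

/-- The category of `M`-coalgebras in `Top`: pairs of a nondegenerate functor `X : A ⥤ Top` and a
natural transformation `X ⟶ M ⊗ X`, with the usual coalgebra maps. -/
abbrev TopCoalgebra (M : CatModule A) : Type (u + 1) :=
  ObjectProperty.FullSubcategory
    (fun X : Endofunctor.Coalgebra (moduleTensorFunctor M) => NondegenerateTop X.V)

end Coalgebras

section Solution

variable {A : Type u} [SmallCategory A] {M : CatModule A}

/-- An infinite sequence `⋯ ⇸ a₂ ⇸ a₁ ⇸ a₀ = a` of module elements, an object of the category
`𝓘 a`; here `obj n` is `aₙ₊₁`, `first` is `m₁ : a₁ ⇸ a` and `rest n` is `mₙ₊₂ : aₙ₊₂ ⇸ aₙ₊₁`. -/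
structure InfSeq (M : CatModule A) (a : A) : Type u where
  obj : ℕ → A
  first : Elt M (obj 0) a
  rest : ∀ n, Elt M (obj (n + 1)) (obj n)

/-- A map in `𝓘 a`: a commutative ladder whose rightmost vertical arrow is the identity of `a`;
here `app n` is `fₙ₊₁`. -/
@[ext]
structure InfSeq.Hom {a : A} (s t : InfSeq M a) : Type u where
  app : ∀ n, s.obj n ⟶ t.obj n
  first : s.first = ract M t.first (app 0)
  rest : ∀ n, lact M (app n) (s.rest n) = ract M (t.rest n) (app (n + 1))

/-- The category `𝓘 a`. -/
instance InfSeq.category (M : CatModule A) (a : A) : SmallCategory (InfSeq M a) where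
  Hom s t := InfSeq.Hom s t
  id s :=
    { app := fun n => 𝟙 _
      first := (ract_id M _).symm
      rest := fun n => by rw [lact_id, ract_id] }
  comp {s t r} α β :=
    { app := fun n => α.app n ≫ β.app n
      first := by rw [ract_comp, ← β.first, ← α.first]
      rest := fun n => by rw [lact_comp, α.rest, ← lact_ract, β.rest, ract_comp] }
  id_comp _ := InfSeq.Hom.ext (funext fun _ => Category.id_comp _)
  comp_id _ := InfSeq.Hom.ext (funext fun _ => Category.comp_id _)
  assoc _ _ _ := InfSeq.Hom.ext (funext fun _ => Category.assoc _ _ _)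

/-- The functor `𝓘 f : 𝓘 a ⥤ 𝓘 a'`, replacing `m₁` by `f m₁`. -/
def InfSeq.pushforward (M : CatModule A) {a a' : A} (f : a ⟶ a') : InfSeq M a ⥤ InfSeq M a' where
  obj s := ⟨s.obj, lact M f s.first, s.rest⟩
  map {s t} α :=
    { app := α.app
      first := by
        change lact M f s.first = ract M (lact M f t.first) (α.app 0)
        rw [lact_ract, ← α.first]
      rest := α.rest }

/-- The functor `I : A ⥤ Set`, where `I a` is the set of connected components of `𝓘 a`. -/
def solution (M : CatModule A) : A ⥤ Type u where
  obj a := CategoryTheory.ConnectedComponents (InfSeq M a)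
  map f := ↾(InfSeq.pushforward M f).mapConnectedComponents
  map_id a := by
    ext t
    induction t using Quotient.inductionOn with
    | h s =>
      change CategoryTheory.ConnectedComponents.mk ((InfSeq.pushforward M (𝟙 a)).obj s) =
        CategoryTheory.ConnectedComponents.mk s
      simp [InfSeq.pushforward, lact_id]
  map_comp f g := by
    ext t
    induction t using Quotient.inductionOn with
    | h s =>
      change CategoryTheory.ConnectedComponents.mk ((InfSeq.pushforward M (f ≫ g)).obj s) =
        CategoryTheory.ConnectedComponents.mk ((InfSeq.pushforward M g).obj ((InfSeq.pushforward M f).obj s))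
      simp [InfSeq.pushforward, lact_comp]

/-- The element `[⋯ ⇸ a₁ ⇸ a]` of `I a`. -/
def component {a : A} (s : InfSeq M a) : (solution M).obj a := CategoryTheory.ConnectedComponents.mk s

theorem component_eq_of_hom {a : A} {s t : InfSeq M a} (α : s ⟶ t) :
    component s = component t :=
  Quotient.sound (Zigzag.of_hom α)

/-- A function on sequences that is constant along ladders descends to `I a`. -/
def solutionLift {a : A} {T : Type u} (F : InfSeq M a → T)
    (hF : ∀ s t : InfSeq M a, (s ⟶ t) → F s = F t) : (solution M).obj a → T :=
  Quotient.lift F (fun s t h => by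
    induction h with
    | refl => rfl
    | tail _ h ih =>
      rcases h with ⟨⟨α⟩⟩ | ⟨⟨α⟩⟩
      · exact ih.trans (hF _ _ α)
      · exact ih.trans (hF _ _ α).symm)

theorem solutionLift_component {a : A} {T : Type u} (F : InfSeq M a → T)
    (hF : ∀ s t : InfSeq M a, (s ⟶ t) → F s = F t) (s : InfSeq M a) :
    solutionLift F hF (component s) = F s :=
  rfl

/-- The sequence `⋯ ⇸ a₂ ⇸ a₁`. -/
def InfSeq.tail {a : A} (s : InfSeq M a) : InfSeq M (s.obj 0) :=
  ⟨fun n => s.obj (n + 1), s.rest 0, fun n => s.rest (n + 1)⟩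

/-- The components `I a → (M ⊗ I) a`, `[⋯ ⇸ a₁ ⇸ a] ↦ m₁ ⊗ [⋯ ⇸ a₂ ⇸ a₁]`, of the coalgebra
structure of `I`. -/
def solutionStr (M : CatModule A) (a : A) :
    (solution M).obj a → Tensor (colPresheaf M a) (solution M) :=
  solutionLift
    (fun s => tmul (colPresheaf M a) (solution M) (a := s.obj 0) s.first (component s.tail))
    (fun s t α => by
      have h1 : component ((InfSeq.pushforward M (α.app 0)).obj s.tail) = component t.tail :=
        component_eq_of_hom
          { app := fun n => α.app (n + 1)
            first := α.rest 0
            rest := fun n => α.rest (n + 1) }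
      have h2 := tmul_glue (colPresheaf M a) (solution M) (α.app 0) t.first (component s.tail)
      change tmul (colPresheaf M a) (solution M) (ract M t.first (α.app 0)) (component s.tail) =
        tmul (colPresheaf M a) (solution M) (a := t.obj 0) t.first
          (component ((InfSeq.pushforward M (α.app 0)).obj s.tail)) at h2
      rw [h1, ← α.first] at h2
      exact h2)

/-- The functor `𝓘 d ⥤ 𝓘 c` appending a module element `q : d ⇸ c` at the right-hand end. -/
def InfSeq.append {d c : A} (q : Elt M d c) : InfSeq M d ⥤ InfSeq M c where
  obj s :=
    { obj := fun n => match n with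
        | 0 => d
        | n + 1 => s.obj n
      first := q
      rest := fun n => match n with
        | 0 => s.first
        | n + 1 => s.rest n }
  map α :=
    { app := fun n => match n with
        | 0 => 𝟙 d
        | n + 1 => α.app n
      first := (ract_id M q).symm
      rest := fun n => match n with
        | 0 => (lact_id M _).trans α.first
        | n + 1 => α.rest n }
  map_id _ := InfSeq.Hom.ext (funext fun n => match n with
    | 0 => rfl
    | _ + 1 => rfl)
  map_comp _ _ := InfSeq.Hom.ext (funext fun n => match n with
    | 0 => (Category.id_comp _).symm
    | _ + 1 => rfl)

/-- The map `φ_q : I d → I c`, `[⋯ ⇸ d₁ ⇸ d] ↦ [⋯ ⇸ d₁ ⇸ d ⇸ c]`. -/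
def phi {d c : A} (q : Elt M d c) : (solution M).obj d → (solution M).obj c :=
  (InfSeq.append q).mapConnectedComponents

/-- Finite sequences `b = bₙ ⇸ ⋯ ⇸ b₁ ⇸ b₀ = a` of module elements, of any length `n ≥ 0`. -/
inductive FinSeq (M : CatModule A) (b : A) : A → Type u
  | nil : FinSeq M b b
  | snoc {c a : A} (p : FinSeq M b c) (q : Elt M c a) : FinSeq M b a

/-- The composite `φ_{p₁} ⋯ φ_{pₙ} : I bₙ → I a`. -/
def FinSeq.phi {b : A} : {a : A} → FinSeq M b a → (solution M).obj b → (solution M).obj a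
  | _, .nil => id
  | _, .snoc p q => fun t => SelfSim.phi q (p.phi t)

/-- The topology on `I a` generated by declaring each set `φ_{p₁} ⋯ φ_{pₙ} (I bₙ)` closed. -/
instance solutionTopology (M : CatModule A) (a : A) : TopologicalSpace ((solution M).obj a) :=
  TopologicalSpace.generateFrom
    {U | ∃ (b : A) (p : FinSeq M b a), U = (Set.range p.phi)ᶜ}

/-- `I` as a functor to `Top`, once the maps `I f` are known to be continuous. -/
def solutionTop (M : CatModule A)
    (hI : ∀ ⦃a a' : A⦄ (f : a ⟶ a'), Continuous ((solution M).map f)) : A ⥤ TopCat.{u} where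
  obj a := TopCat.of ((solution M).obj a)
  map f := TopCat.ofHom ⟨(solution M).map f, hI f⟩
  map_id a := by
    ext t
    exact ConcreteCategory.congr_hom ((solution M).map_id a) t
  map_comp f g := by
    ext t
    exact ConcreteCategory.congr_hom ((solution M).map_comp f g) t

/-- `(I, ι)` as a coalgebra for `M ⊗ -` on `[A, Top]`, once the maps `I f` and `ι_a` are known to be
continuous. -/
def solutionCoalgebra (M : CatModule A)
    (hI : ∀ ⦃a a' : A⦄ (f : a ⟶ a'), Continuous ((solution M).map f))
    (hι : ∀ a : A, Continuous (solutionStr M a)) :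
    Endofunctor.Coalgebra (moduleTensorFunctor M) where
  V := solutionTop M hI
  str :=
    { app := fun a => TopCat.ofHom ⟨solutionStr M a, hι a⟩
      naturality := fun a a' f => by
        ext t
        induction t using Quotient.inductionOn with
        | h s => rfl }

end Solution

end SelfSim

/-!
Nondegeneracy of `X` says exactly that in the category of elements of `X` every cospan completes
to a square and every parallel pair to a fork (`IsFlat`); equality in `Y ⊗ X` is then witnessed by
a single span (`IsFlat.tmul_eq_iff`).

Condition S provides squares and forks over each single rung of an infinite ladder.  Flatness of
`M` carries such a square from one rung to the preceding one, and finiteness of `M` together with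
König's lemma assembles them into infinite ladders (`exists_ladder_square`, `exists_ladder_fork`).
It follows that two sequences in one component of `𝓘 a` are joined by one span, that `I` is flat,
and that `ι` is bijective with inverse `m ⊗ t ↦ φ_m t`.

For a coalgebra `X`, the cylinder of length `n` along a sequence `s` consists of the elements that
can be unfolded `n` times along `s`; in `I` these are the basic closed sets.  Three facts about
cylinders carry the argument.  For an ultrafilter on `X a` there is a sequence all of whose
cylinders belong to it (`SetCoalgebra.exists_eventually_mem_cylinder`), since `M` is finite.  If
the cylinders along `s` and `t` in `I` meet at every length then `[s] = [t]`
(`component_eq_of_cylinder_inter`), by flatness of `I` and König's lemma.  An ultrafilter on `I a`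
containing all cylinders along `s` converges to `[s]` (`ultrafilter_le_nhds_component`).  Hence an
ultrafilter on `I a` has exactly one limit, so `I a` is compact Hausdorff, and the continuity of
`I f`, `φ_q` and `ι_a` follows.

An element `x` of a nondegenerate coalgebra has a resolution, an infinite sequence along which it
unfolds forever, and any two resolutions are joined by a span.  Sending `x` to the component of its
resolution is a map of coalgebras `X → I`.  It is the only one, because a map of coalgebras sends
`x` into every cylinder along its resolution.  It is continuous because cylinders in `X` are
closed: for closed maps `X f` and finite `M`, each map `m ⊗ -` is closed (`isClosedMap_tmul`).
-/

namespace SelfSim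

/-! ### Flatness in terms of elements -/

section Flat

variable {A : Type u} [SmallCategory A]

/-- The elementary form of nondegeneracy: in the category of elements of `X`, every cospan
completes to a commutative square and every parallel pair to a fork. -/
structure IsFlat (X : A ⥤ Type u) : Prop where
  square : ∀ {a b a' : A} (f : a ⟶ b) (f' : a' ⟶ b) (x : X.obj a) (x' : X.obj a'),
    X.map f x = X.map f' x' →
    ∃ (c : A) (g : c ⟶ a) (g' : c ⟶ a') (z : X.obj c),
      g ≫ f = g' ≫ f' ∧ X.map g z = x ∧ X.map g' z = x'
  fork : ∀ {a b : A} (f f' : a ⟶ b) (x : X.obj a), X.map f x = X.map f' x →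
    ∃ (c : A) (g : c ⟶ a) (z : X.obj c), g ≫ f = g ≫ f' ∧ X.map g z = x

theorem map_comp_apply (X : A ⥤ Type u) {a b c : A} (f : a ⟶ b) (g : b ⟶ c) (x : X.obj a) :
    X.map (f ≫ g) x = X.map g (X.map f x) := by
  simp

/-- The evaluation map `A(-, a) ⊗ X → X a`, `h ⊗ x ↦ X h x`. -/
def yonedaTensor (X : A ⥤ Type u) (a : A) : Tensor (yoneda.obj a) X → X.obj a :=
  Quot.lift (fun p => X.map (show p.1.1 ⟶ a from p.1.2) p.2) (by
    rintro _ _ ⟨g, y, x⟩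
    exact map_comp_apply X g y x)

theorem tmul_yoneda_eq (X : A ⥤ Type u) {a b : A} (f : a ⟶ b) (x : X.obj a) :
    tmul (yoneda.obj b) X (a := a) f x = tmul (yoneda.obj b) X (a := b) (𝟙 b) (X.map f x) := by
  have := tmul_glue (yoneda.obj b) X f (𝟙 b) x
  rw [← this]
  congr 1
  exact (Category.comp_id f).symm

theorem Tensor.exists_tmul {Y : Aᵒᵖ ⥤ Type u} {X : A ⥤ Type u} (t : Tensor Y X) :
    ∃ (a : A) (y : Y.obj (op a)) (x : X.obj a), t = tmul Y X y x := by
  induction t using Quot.ind with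
  | mk p => exact ⟨p.1.1, p.1.2, p.2, rfl⟩

/-- Testing preservation of limits on pullbacks and equalizers of representables gives flatness. -/
theorem Nondegenerate.isFlat {X : A ⥤ Type u} (hX : Nondegenerate X) : IsFlat X where
  square {a b a'} f f' x x' h := by
    have := hX WalkingCospan
    have hl := isLimitPullbackConeMapOfIsLimit (tensorWith X) _
      (pullbackIsPullback (yoneda.map f) (yoneda.map f'))
    let e := PullbackCone.IsLimit.equivPullbackObj hl
    let p : Types.PullbackObj ((tensorWith X).map (yoneda.map f))
        ((tensorWith X).map (yoneda.map f')) :=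
      ⟨(tmul (yoneda.obj a) X (a := a) (𝟙 a) x, tmul (yoneda.obj a') X (a := a') (𝟙 a') x'), by
        have h1 := tmul_yoneda_eq X f x
        have h2 := tmul_yoneda_eq X f' x'
        rw [h, ← h2] at h1
        change tmul (yoneda.obj b) X (a := a) (𝟙 a ≫ f) x =
          tmul (yoneda.obj b) X (a := a') (𝟙 a' ≫ f') x'
        rwa [Category.id_comp, Category.id_comp]⟩
    obtain ⟨t, ht⟩ := e.surjective p
    obtain ⟨c, y, z, rfl⟩ := Tensor.exists_tmul (show Tensor _ X from t)
    have h1 : tensorMap (pullback.fst (yoneda.map f) (yoneda.map f')) (𝟙 X) (tmul _ X y z) =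
        tmul (yoneda.obj a) X (a := a) (𝟙 a) x := by
      have := PullbackCone.IsLimit.equivPullbackObj_apply_fst hl (tmul _ X y z)
      exact this.symm.trans (congrArg (fun q => q.1.1) ht)
    have h2 : tensorMap (pullback.snd (yoneda.map f) (yoneda.map f')) (𝟙 X) (tmul _ X y z) =
        tmul (yoneda.obj a') X (a := a') (𝟙 a') x' := by
      have := PullbackCone.IsLimit.equivPullbackObj_apply_snd hl (tmul _ X y z)
      exact this.symm.trans (congrArg (fun q => q.1.2) ht)
    refine ⟨c, (pullback.fst (yoneda.map f) (yoneda.map f')).app (op c) y,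
      (pullback.snd (yoneda.map f) (yoneda.map f')).app (op c) y, z, ?_, ?_, ?_⟩
    · have := ConcreteCategory.congr_hom (NatTrans.congr_app
        (pullback.condition (f := yoneda.map f) (g := yoneda.map f')) (op c)) y
      exact this
    · exact (congrArg (yonedaTensor X a) h1).trans (by simp [yonedaTensor, tmul])
    · exact (congrArg (yonedaTensor X a') h2).trans (by simp [yonedaTensor, tmul])
  fork {a b} f f' x h := by
    have := hX WalkingParallelPair
    have hl := isLimitForkMapOfIsLimit (tensorWith X) _
      (equalizerIsEqualizer (yoneda.map f) (yoneda.map f'))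
    have hs : ∃! t, (tensorWith X).map (equalizer.ι (yoneda.map f) (yoneda.map f')) t =
        tmul (yoneda.obj a) X (a := a) (𝟙 a) x := by
      refine (Types.type_equalizer_iff_unique _ _).1 ⟨hl⟩ _ ?_
      have h1 := tmul_yoneda_eq X f x
      have h2 := tmul_yoneda_eq X f' x
      rw [h, ← h2] at h1
      change tmul (yoneda.obj b) X (a := a) (𝟙 a ≫ f) x =
        tmul (yoneda.obj b) X (a := a) (𝟙 a ≫ f') x
      rwa [Category.id_comp, Category.id_comp]
    obtain ⟨t, ht, -⟩ := hs
    obtain ⟨c, y, z, rfl⟩ := Tensor.exists_tmul (show Tensor _ X from t)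
    refine ⟨c, (equalizer.ι (yoneda.map f) (yoneda.map f')).app (op c) y, z, ?_, ?_⟩
    · have := ConcreteCategory.congr_hom (NatTrans.congr_app
        (equalizer.condition (yoneda.map f) (yoneda.map f')) (op c)) y
      exact this
    · exact (congrArg (yonedaTensor X a) ht).trans (by simp [yonedaTensor, tmul])

variable {X : A ⥤ Type u}

/-- In a tensor product with a flat functor, equality of generators is witnessed by one span. -/
theorem IsFlat.tmul_eq_iff (hX : IsFlat X) {Y : Aᵒᵖ ⥤ Type u} {a a' : A} {y : Y.obj (op a)}
    {y' : Y.obj (op a')} {x : X.obj a} {x' : X.obj a'} :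
    tmul Y X y x = tmul Y X y' x' ↔
      ∃ (c : A) (g : c ⟶ a) (g' : c ⟶ a') (z : X.obj c),
        Y.map g.op y = Y.map g'.op y' ∧ X.map g z = x ∧ X.map g' z = x' := by
  let r : PreTensor Y X → PreTensor Y X → Prop := fun p p' =>
    ∃ (c : A) (g : c ⟶ p.1.1) (g' : c ⟶ p'.1.1) (z : X.obj c),
      Y.map g.op p.1.2 = Y.map g'.op p'.1.2 ∧ X.map g z = p.2 ∧ X.map g' z = p'.2
  constructor
  · intro h
    suffices H : ∀ p p', Relation.EqvGen (TensorRel Y X) p p' → r p p' from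
      H _ _ (Quot.eqvGen_exact h)
    intro p p' h
    induction h with
    | rel p p' hp =>
      obtain ⟨g, y, x⟩ := hp
      exact ⟨_, 𝟙 _, g, x, by simp, by simp, rfl⟩
    | refl p => exact ⟨_, 𝟙 _, 𝟙 _, p.2, rfl, by simp, by simp⟩
    | symm p p' _ ih =>
      obtain ⟨c, g, g', z, h1, h2, h3⟩ := ih
      exact ⟨c, g', g, z, h1.symm, h3, h2⟩
    | trans p p' p'' _ _ ih ih' =>
      obtain ⟨c, g, g', z, h1, h2, h3⟩ := ih
      obtain ⟨d, k, k', w, h4, h5, h6⟩ := ih'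
      obtain ⟨e, i, i', v, h7, rfl, rfl⟩ := hX.square g' k z w (h3.trans h5.symm)
      refine ⟨e, i ≫ g, i' ≫ k', v, ?_, ?_, ?_⟩
      · rw [op_comp, op_comp, map_comp_apply, map_comp_apply, h1, ← h4, ← map_comp_apply,
          ← map_comp_apply, ← op_comp, ← op_comp, h7]
      · rw [map_comp_apply, h2]
      · rw [map_comp_apply, h6]
  · rintro ⟨c, g, g', z, h1, rfl, rfl⟩
    rw [← tmul_glue, ← tmul_glue, h1]

/-- For equal right-hand factors the span of `IsFlat.tmul_eq_iff` may be taken to be a single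
arrow. -/
theorem IsFlat.exists_of_tmul_eq (hX : IsFlat X) {Y : Aᵒᵖ ⥤ Type u} {a : A}
    {y y' : Y.obj (op a)} {x : X.obj a} (h : tmul Y X y x = tmul Y X y' x) :
    ∃ (c : A) (g : c ⟶ a) (z : X.obj c), Y.map g.op y = Y.map g.op y' ∧ X.map g z = x := by
  obtain ⟨c, g, g', z, h1, h2, h3⟩ := hX.tmul_eq_iff.1 h
  obtain ⟨d, k, w, h4, rfl⟩ := hX.fork g g' z (h2.trans h3.symm)
  refine ⟨d, k ≫ g, w, ?_, by rw [map_comp_apply, h2]⟩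
  conv_rhs => rw [h4]
  rw [op_comp, op_comp, map_comp_apply, map_comp_apply, h1]

/-- Finitely many refinements of `(a, x)` in the category of elements have a common one. -/
theorem IsFlat.exists_common (hX : IsFlat X) {a : A} (x : X.obj a) {ι : Type*} [Finite ι]
    (P : ι → ∀ c : A, (c ⟶ a) → X.obj c → Prop)
    (hP : ∀ i c g z, P i c g z → ∀ (d : A) (k : d ⟶ c) (w : X.obj d), X.map k w = z →
      P i d (k ≫ g) w)
    (h : ∀ i, ∃ (c : A) (g : c ⟶ a) (z : X.obj c), X.map g z = x ∧ P i c g z) :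
    ∃ (c : A) (g : c ⟶ a) (z : X.obj c), X.map g z = x ∧ ∀ i, P i c g z := by
  classical
  cases nonempty_fintype ι
  suffices H : ∀ s : Finset ι, ∃ (c : A) (g : c ⟶ a) (z : X.obj c), X.map g z = x ∧
      ∀ i ∈ s, P i c g z by
    obtain ⟨c, g, z, hz, hs⟩ := H Finset.univ
    exact ⟨c, g, z, hz, fun i => hs i (Finset.mem_univ i)⟩
  intro s
  induction s using Finset.induction_on with
  | empty => exact ⟨a, 𝟙 a, x, by simp, by simp⟩
  | insert i s _ ih =>
    obtain ⟨c, g, z, hz, hs⟩ := ih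
    obtain ⟨c', g', z', hz', hs'⟩ := h i
    obtain ⟨d, k, k', w, e, rfl, rfl⟩ := hX.square g g' z z' (hz.trans hz'.symm)
    refine ⟨d, k ≫ g, w, by rw [map_comp_apply, hz], fun j hj => ?_⟩
    rcases Finset.mem_insert.1 hj with rfl | hj
    · rw [e]
      exact hP _ _ _ _ hs' _ _ _ rfl
    · exact hP _ _ _ _ (hs j hj) _ _ _ rfl

/-- The category of elements of a flat functor has cofiltered components.  A compatible family over
a finite connected diagram therefore has representatives `y j ⊗ x` with one and the same `x`, over
an object on which the `y j` are themselves compatible. -/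
theorem IsFlat.nondegenerate (hX : IsFlat X) : Nondegenerate X := by
  intro J _ _ _
  have : Finite J := Finite.of_fintype J
  refine ⟨fun {K} => ⟨fun {c} hc => (Types.isLimit_iff _).2 fun s hs => ?_⟩⟩
  have hev (a : A) := (Types.isLimit_iff _).1
    ⟨isLimitOfPreserves ((evaluation Aᵒᵖ (Type u)).obj (op a)) hc⟩
  have hs' : ∀ {j k : J} (u : j ⟶ k), tensorMap (K.map u) (𝟙 X) (s j) = s k := fun u => hs u
  obtain ⟨j₀⟩ : Nonempty J := inferInstance
  refine existsUnique_of_exists_of_unique ?_ ?_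
  · have hrep : ∀ j, ∃ (a : A) (y : (K.obj j).obj (op a)) (x : X.obj a),
        s j = tmul (K.obj j) X y x := fun j => Tensor.exists_tmul (s j)
    choose a y x hsx using hrep
    -- every representative has a common refinement with the one at `j₀`
    have key : ∀ j, ∃ (c : A) (g : c ⟶ a j₀) (z : X.obj c), X.map g z = x j₀ ∧
        ∃ h : c ⟶ a j, X.map h z = x j := by
      have step : ∀ {j k : J} (u : j ⟶ k), ∃ (c : A) (g : c ⟶ a j) (h : c ⟶ a k) (z : X.obj c),
          X.map g z = x j ∧ X.map h z = x k := by
        intro j k u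
        have := hs' u
        rw [hsx, hsx, tensorMap_tmul] at this
        obtain ⟨c, g, h, z, -, h2, h3⟩ := hX.tmul_eq_iff.1 this
        exact ⟨c, g, h, z, h2, h3⟩
      have trans : ∀ {j k : J} (c : A) (g : c ⟶ a j) (h : c ⟶ a k) (z : X.obj c),
          X.map g z = x j → X.map h z = x k → (∃ (c : A) (g : c ⟶ a j₀) (z : X.obj c),
            X.map g z = x j₀ ∧ ∃ h : c ⟶ a j, X.map h z = x j) →
          (∃ (c : A) (g : c ⟶ a j₀) (z : X.obj c), X.map g z = x j₀ ∧
            ∃ h : c ⟶ a k, X.map h z = x k) := by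
        rintro j k c g h z hg hh ⟨d, p, w, hp, q, hq⟩
        obtain ⟨e, i, i', v, -, rfl, rfl⟩ := hX.square g q z w (hg.trans hq.symm)
        exact ⟨e, i' ≫ p, v, by rw [map_comp_apply, hp], i ≫ h, by rw [map_comp_apply, hh]⟩
      intro j
      have hz := isPreconnected_zigzag j₀ j
      induction hz with
      | refl => exact ⟨a j₀, 𝟙 _, x j₀, by simp, 𝟙 _, by simp⟩
      | tail _ hjk ih =>
        rcases hjk with ⟨⟨u⟩⟩ | ⟨⟨u⟩⟩
        · obtain ⟨c, g, h, z, h1, h2⟩ := step u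
          exact trans c g h z h1 h2 ih
        · obtain ⟨c, g, h, z, h1, h2⟩ := step u
          exact trans c h g z h2 h1 ih
    obtain ⟨c₁, g₁, z₁, -, hz₁⟩ := hX.exists_common (x j₀)
      (fun j c _ z => ∃ h : c ⟶ a j, X.map h z = x j)
      (fun j c g z ⟨h, hh⟩ d k w hw => ⟨k ≫ h, by rw [map_comp_apply, hw, hh]⟩) key
    choose h hh using hz₁
    let y₁ (j : J) : (K.obj j).obj (op c₁) := (K.obj j).map (h j).op (y j)
    have hy₁ (j : J) : s j = tmul (K.obj j) X (y₁ j) z₁ := by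
      rw [tmul_glue, hh]
      exact hsx j
    -- over a further refinement the left-hand factors become compatible
    obtain ⟨c₂, g₂, z₂, hz₂, hg₂⟩ := hX.exists_common (ι := Σ (j k : J), (j ⟶ k)) z₁
      (fun u c g _ => (K.obj u.2.1).map g.op ((K.map u.2.2).app _ (y₁ u.1)) =
        (K.obj u.2.1).map g.op (y₁ u.2.1))
      (fun u c g z e d k w hw => by
        rw [op_comp, map_comp_apply, map_comp_apply, e])
      (fun u => by
        have := hs' u.2.2
        rw [hy₁, hy₁, tensorMap_tmul] at this
        obtain ⟨c, g, z, h1, h2⟩ := hX.exists_of_tmul_eq this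
        exact ⟨c, g, z, h2, h1⟩)
    obtain ⟨y₂, hy₂, -⟩ := hev c₂ (fun j => (K.obj j).map g₂.op (y₁ j)) (by
      intro j k u
      have := hg₂ ⟨j, k, u⟩
      exact (NatTrans.naturality_apply (K.map u) g₂.op (y₁ j)).trans this)
    refine ⟨tmul c.pt X y₂ z₂, fun j => ?_⟩
    change tmul (K.obj j) X ((c.π.app j).app (op c₂) y₂) z₂ = s j
    rw [hy₁, ← hz₂, ← tmul_glue]
    exact congrArg (fun w => tmul (K.obj j) X w z₂) (hy₂ j)
  · intro t t' ht ht'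
    obtain ⟨a, y, x, rfl⟩ := Tensor.exists_tmul (show Tensor c.pt X from t)
    obtain ⟨a', y', x', rfl⟩ := Tensor.exists_tmul (show Tensor c.pt X from t')
    have e (j : J) : tmul (K.obj j) X ((c.π.app j).app (op a) y) x =
        tmul (K.obj j) X ((c.π.app j).app (op a') y') x' := (ht j).trans (ht' j).symm
    obtain ⟨b, g, g', z, -, rfl, rfl⟩ := hX.tmul_eq_iff.1 (e j₀)
    obtain ⟨d, k, w, hw, hk⟩ := hX.exists_common z
      (fun j d k _ => (K.obj j).map k.op ((c.π.app j).app (op b) (c.pt.map g.op y)) =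
        (K.obj j).map k.op ((c.π.app j).app (op b) (c.pt.map g'.op y')))
      (fun j c g z e d k w hw => by
        rw [op_comp, map_comp_apply, map_comp_apply, e])
      (fun j => by
        have := e j
        rw [← tmul_glue, ← tmul_glue, ← NatTrans.naturality_apply,
          ← NatTrans.naturality_apply] at this
        obtain ⟨c, g, z, h1, h2⟩ := hX.exists_of_tmul_eq this
        exact ⟨c, g, z, h2, h1⟩)
    have hyy : c.pt.map k.op (c.pt.map g.op y) = c.pt.map k.op (c.pt.map g'.op y') := by
      refine (hev d (fun j => (c.π.app j).app (op d) (c.pt.map k.op (c.pt.map g'.op y')))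
        ?_).unique (fun j => ?_) (fun j => rfl)
      · intro i j u
        have := ConcreteCategory.congr_hom (NatTrans.congr_app (c.w u) (op d))
          (c.pt.map k.op (c.pt.map g'.op y'))
        exact this
      · have := hk j
        rw [← NatTrans.naturality_apply, ← NatTrans.naturality_apply] at this
        exact this
    change tmul c.pt X y (X.map g z) = tmul c.pt X y' (X.map g' z)
    rw [← tmul_glue, ← tmul_glue, ← hw, ← tmul_glue, ← tmul_glue, hyy]

end Flat

/-! ### Infinite paths -/

/-- Dependent recursion along a total relation. -/
theorem exists_path {T : ℕ → Type*} (R : ∀ k, T k → T (k + 1) → Prop) (t₀ : T 0)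
    (h : ∀ k t, ∃ t', R k t t') : ∃ τ : ∀ k, T k, τ 0 = t₀ ∧ ∀ k, R k (τ k) (τ (k + 1)) := by
  choose next hnext using h
  exact ⟨fun k => Nat.rec t₀ next k, rfl, fun k => hnext _ _⟩

/-- A decreasing sequence of nonempty subsets of a finite type has nonempty intersection. -/
theorem exists_forall_of_finite {T : Type*} [Finite T] (P : ℕ → T → Prop)
    (hP : ∀ n t, P (n + 1) t → P n t) (h : ∀ n, ∃ t, P n t) : ∃ t, ∀ n, P n t := by
  choose t ht using h
  obtain ⟨t', ht'⟩ := Finite.exists_infinite_fiber t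
  refine ⟨t', fun n => ?_⟩
  obtain ⟨m, hm, hnm⟩ := (Set.infinite_coe_iff.1 ht').exists_gt n
  have := ht m
  rw [show t m = t' from hm] at this
  exact antitone_nat_of_succ_le (f := fun n => P n t') (fun n => hP n t') hnm.le this

/-- König's lemma for finite levels `T k`.  The predicate `P k n t` is to be thought of as saying
that `t` at level `k` can be continued `n` times; all that is needed is that it allows one step of
`R` at the cost of one unit of `n`.  The starting points are restricted by `Q`. -/
theorem exists_path_of_finite {T : ℕ → Type*} [∀ k, Finite (T k)]
    (R : ∀ k, T k → T (k + 1) → Prop) (P : ∀ k, ℕ → T k → Prop) (Q : T 0 → Prop)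
    (hP : ∀ k n t, P k (n + 1) t → P k n t)
    (hR : ∀ k n t, P k (n + 1) t → ∃ t', R k t t' ∧ P (k + 1) n t')
    (h : ∀ n, ∃ t, Q t ∧ P 0 n t) :
    ∃ τ : ∀ k, T k, Q (τ 0) ∧ ∀ k, R k (τ k) (τ (k + 1)) := by
  obtain ⟨t₀, ht₀⟩ := exists_forall_of_finite (fun n t => Q t ∧ P 0 n t)
    (fun n t ht => ⟨ht.1, hP _ _ _ ht.2⟩) h
  obtain ⟨τ, hτ₀, hτ⟩ := exists_path (T := fun k => {t : T k // ∀ n, P k n t})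
    (fun k t t' => R k t.1 t'.1) ⟨t₀, fun n => (ht₀ n).2⟩ (fun k t => by
      obtain ⟨t', ht'⟩ := exists_forall_of_finite (fun n t' => R k t.1 t' ∧ P (k + 1) n t')
        (fun n t' ht' => ⟨ht'.1, hP _ _ _ ht'.2⟩) (fun n => hR k n t.1 (t.2 (n + 1)))
      exact ⟨⟨t', fun n => (ht' n).2⟩, (ht' 0).1⟩)
  refine ⟨fun k => (τ k).1, ?_, hτ⟩
  change Q (τ 0).1
  rw [hτ₀]
  exact (ht₀ 0).1

/-- `Extends R n k t`: there is a path of length `n` starting from `t` at level `k`. -/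
def Extends {T : ℕ → Type*} (R : ∀ k, T k → T (k + 1) → Prop) : ℕ → ∀ k, T k → Prop
  | 0, _, _ => True
  | n + 1, k, t => ∃ t', R k t t' ∧ Extends R n (k + 1) t'

theorem Extends.of_succ {T : ℕ → Type*} {R : ∀ k, T k → T (k + 1) → Prop} :
    ∀ {n k : ℕ} {t : T k}, Extends R (n + 1) k t → Extends R n k t
  | 0, _, _, _ => trivial
  | _ + 1, _, _, ⟨t', h, h'⟩ => ⟨t', h, h'.of_succ⟩

/-- König's lemma for paths running in the opposite direction: if every element of `T (k + 1)` is
related to some element of `T k`, the finite levels carry an infinite path. -/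
theorem exists_path_of_finite_of_backward {T : ℕ → Type*} [∀ k, Finite (T k)]
    [∀ k, Nonempty (T k)] (R : ∀ k, T k → T (k + 1) → Prop) (h : ∀ k t', ∃ t, R k t t') :
    ∃ τ : ∀ k, T k, ∀ k, R k (τ k) (τ (k + 1)) := by
  have key : ∀ n k, ∃ t, Extends R n k t := by
    intro n
    induction n with
    | zero => exact fun k => ⟨Classical.arbitrary _, trivial⟩
    | succ n ih =>
      intro k
      obtain ⟨t', ht'⟩ := ih (k + 1)
      obtain ⟨t, ht⟩ := h k t'
      exact ⟨t, t', ht, ht'⟩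
  obtain ⟨τ, -, hτ⟩ := exists_path_of_finite R (fun k n t => Extends R n k t) (fun _ => True)
    (fun _ _ _ => Extends.of_succ) (fun _ _ _ h => h) (fun n => by simpa using key n 0)
  exact ⟨τ, hτ⟩

/-! ### Completing infinite ladders -/

section Ladders

variable {A : Type u} [SmallCategory A] {M : CatModule A}

theorem CatModule.IsFinite.finite_elt (hM : M.IsFinite) (a : A) : Finite (Σ b : A, Elt M b a) := by
  have := hM a
  refine Finite.of_injective
    (fun m : (Σ b : A, Elt M b a) =>
      (⟨m.1, m.1, 𝟙 _, m.2⟩ : Σ (b' : A) (b : A), (b' ⟶ b) × Elt M b a)) ?_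
  rintro ⟨b, m⟩ ⟨b', m'⟩ h
  simp only [Sigma.mk.injEq] at h
  obtain ⟨rfl, h⟩ := h
  simp only [heq_eq_eq, Sigma.mk.injEq, Prod.mk.injEq, true_and] at h
  rw [h]

theorem CatModule.IsFinite.finite_over (hM : M.IsFinite) {b a : A} (m : Elt M b a) :
    Finite (Σ c : A, (c ⟶ b)) := by
  have := hM a
  refine Finite.of_injective
    (fun g : (Σ c : A, (c ⟶ b)) =>
      (⟨g.1, b, g.2, m⟩ : Σ (b' : A) (b : A), (b' ⟶ b) × Elt M b a)) ?_
  rintro ⟨c, g⟩ ⟨c', g'⟩ h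
  simp only [Sigma.mk.injEq] at h
  obtain ⟨rfl, h⟩ := h
  simp only [heq_eq_eq, Sigma.mk.injEq, Prod.mk.injEq, true_and, and_true] at h
  rw [h]

theorem CatModule.IsFinite.finite_span (hM : M.IsFinite) {b a b' a' : A} (m : Elt M b a)
    (m' : Elt M b' a') : Finite (Σ c : A, (c ⟶ b) × (c ⟶ b')) := by
  have := hM.finite_over m
  have := hM.finite_over m'
  refine Finite.of_injective
    (fun g : (Σ c : A, (c ⟶ b) × (c ⟶ b')) =>
      ((⟨g.1, g.2.1⟩, ⟨g.1, g.2.2⟩) : (Σ c : A, (c ⟶ b)) × (Σ c : A, (c ⟶ b')))) ?_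
  rintro ⟨c, g, k⟩ ⟨c', g', k'⟩ h
  simp only [Prod.mk.injEq, Sigma.mk.injEq] at h
  obtain ⟨⟨rfl, h⟩, -, h'⟩ := h
  rw [eq_of_heq h, eq_of_heq h']

/-- Condition S1 gives commutative squares at each single level; flatness of `M` pulls a square at
level `k + 1` back to one at level `k`, and König's lemma assembles these into an infinite ladder.
The elements `m₀` and `m₀'` only serve to make level `0` finite. -/
theorem exists_ladder_square (hM : IsSelfSimilaritySystem M) (hS : ConditionS M)
    {a b a' : ℕ → A} {m : ∀ n, Elt M (a (n + 1)) (a n)} {p : ∀ n, Elt M (b (n + 1)) (b n)}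
    {m' : ∀ n, Elt M (a' (n + 1)) (a' n)} {f : ∀ n, a n ⟶ b n} {f' : ∀ n, a' n ⟶ b n}
    (hf : ∀ n, lact M (f n) (m n) = ract M (p n) (f (n + 1)))
    (hf' : ∀ n, lact M (f' n) (m' n) = ract M (p n) (f' (n + 1)))
    {x x' : A} (m₀ : Elt M (a 0) x) (m₀' : Elt M (a' 0) x') :
    ∃ (c : ℕ → A) (q : ∀ n, Elt M (c (n + 1)) (c n)) (g : ∀ n, c n ⟶ a n) (g' : ∀ n, c n ⟶ a' n),
      (∀ n, g n ≫ f n = g' n ≫ f' n) ∧ (∀ n, lact M (g n) (q n) = ract M (m n) (g (n + 1))) ∧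
      ∀ n, lact M (g' n) (q n) = ract M (m' n) (g' (n + 1)) := by
  let T (k : ℕ) := {t : Σ c : A, (c ⟶ a k) × (c ⟶ a' k) // t.2.1 ≫ f k = t.2.2 ≫ f' k}
  have hfin (k : ℕ) : Finite (T k) := by
    cases k with
    | zero =>
      have := hM.finite.finite_span m₀ m₀'
      exact Subtype.finite
    | succ k =>
      have := hM.finite.finite_span (m k) (m' k)
      exact Subtype.finite
  have (k : ℕ) : Nonempty (T k) := by
    obtain ⟨c, g, g', h⟩ := hS.square (fun n => a (k + n)) (fun n => b (k + n))
      (fun n => a' (k + n)) (fun n => m (k + n)) (fun n => p (k + n)) (fun n => m' (k + n))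
      (fun n => f (k + n)) (fun n => f' (k + n)) (fun n => hf (k + n)) (fun n => hf' (k + n))
    exact ⟨⟨⟨c, g, g'⟩, h⟩⟩
  obtain ⟨τ, hτ⟩ := exists_path_of_finite_of_backward (T := T)
    (fun k t t' => ∃ q : Elt M t'.1.1 t.1.1, lact M t.1.2.1 q = ract M (m k) t'.1.2.1 ∧
      lact M t.1.2.2 q = ract M (m' k) t'.1.2.2) (by
      rintro k ⟨⟨c, g, g'⟩, h⟩
      have e : lact M (f k) (ract M (m k) g) = lact M (f' k) (ract M (m' k) g') := by
        rw [← lact_ract, ← lact_ract, hf, hf', ← ract_comp, ← ract_comp]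
        exact congrArg _ h
      obtain ⟨d, i, i', q, h1, h2, h3⟩ := (hM.nondegenerate c).isFlat.square _ _ _ _ e
      exact ⟨⟨⟨d, i, i'⟩, h1⟩, q, h2, h3⟩)
  choose q hq hq' using hτ
  exact ⟨fun k => (τ k).1.1, q, fun k => (τ k).1.2.1, fun k => (τ k).1.2.2, fun k => (τ k).2, hq,
    hq'⟩

/-- The analogue of `exists_ladder_square` for parallel pairs, from condition S2. -/
theorem exists_ladder_fork (hM : IsSelfSimilaritySystem M) (hS : ConditionS M)
    {a b : ℕ → A} {m : ∀ n, Elt M (a (n + 1)) (a n)} {p : ∀ n, Elt M (b (n + 1)) (b n)}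
    {f f' : ∀ n, a n ⟶ b n}
    (hf : ∀ n, lact M (f n) (m n) = ract M (p n) (f (n + 1)))
    (hf' : ∀ n, lact M (f' n) (m n) = ract M (p n) (f' (n + 1)))
    {x : A} (m₀ : Elt M (a 0) x) :
    ∃ (c : ℕ → A) (q : ∀ n, Elt M (c (n + 1)) (c n)) (g : ∀ n, c n ⟶ a n),
      (∀ n, g n ≫ f n = g n ≫ f' n) ∧ ∀ n, lact M (g n) (q n) = ract M (m n) (g (n + 1)) := by
  let T (k : ℕ) := {t : Σ c : A, (c ⟶ a k) // t.2 ≫ f k = t.2 ≫ f' k}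
  have hfin (k : ℕ) : Finite (T k) := by
    cases k with
    | zero =>
      have := hM.finite.finite_over m₀
      exact Subtype.finite
    | succ k =>
      have := hM.finite.finite_over (m k)
      exact Subtype.finite
  have (k : ℕ) : Nonempty (T k) := by
    obtain ⟨c, g, h⟩ := hS.fork (fun n => a (k + n)) (fun n => b (k + n))
      (fun n => m (k + n)) (fun n => p (k + n))
      (fun n => f (k + n)) (fun n => f' (k + n)) (fun n => hf (k + n)) (fun n => hf' (k + n))
    exact ⟨⟨⟨c, g⟩, h⟩⟩
  obtain ⟨τ, hτ⟩ := exists_path_of_finite_of_backward (T := T)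
    (fun k t t' => ∃ q : Elt M t'.1.1 t.1.1, lact M t.1.2 q = ract M (m k) t'.1.2) (by
      rintro k ⟨⟨c, g⟩, h⟩
      have e : lact M (f k) (ract M (m k) g) = lact M (f' k) (ract M (m k) g) := by
        rw [← lact_ract, ← lact_ract, hf, hf', ← ract_comp, ← ract_comp]
        exact congrArg _ h
      obtain ⟨d, i, q, h1, h2⟩ := (hM.nondegenerate c).isFlat.fork _ _ _ e
      exact ⟨⟨⟨d, i⟩, h1⟩, q, h2⟩)
  choose q hq using hτ
  exact ⟨fun k => (τ k).1.1, q, fun k => (τ k).1.2, fun k => (τ k).2, hq⟩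

/-! ### Connected components of infinite sequences -/

/-- Two sequences in the same component of `𝓘 a` are joined by a single span. -/
theorem exists_span_of_component_eq (hM : IsSelfSimilaritySystem M) (hS : ConditionS M) {a : A}
    {s t : InfSeq M a} (h : component s = component t) :
    ∃ r : InfSeq M a, Nonempty (r ⟶ s) ∧ Nonempty (r ⟶ t) := by
  have hz : Zigzag s t := Quotient.exact h
  have cospan : ∀ {s r t : InfSeq M a} (_ : s ⟶ r) (_ : t ⟶ r),
      ∃ q : InfSeq M a, Nonempty (q ⟶ s) ∧ Nonempty (q ⟶ t) := by
    intro s r t α β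
    obtain ⟨c, q, g, g', h1, h2, h3⟩ :=
      exists_ladder_square hM hS α.rest β.rest s.first t.first
    refine ⟨⟨c, ract M s.first (g 0), q⟩, ⟨⟨g, rfl, h2⟩⟩, ⟨⟨g', ?_, h3⟩⟩⟩
    change ract M s.first (g 0) = ract M t.first (g' 0)
    rw [α.first, β.first, ← ract_comp, ← ract_comp]
    exact congrArg _ (h1 0)
  induction hz with
  | refl => exact ⟨s, ⟨𝟙 s⟩, ⟨𝟙 s⟩⟩
  | tail _ hjk ih =>
    obtain ⟨r, ⟨α⟩, ⟨β⟩⟩ := ih (by apply Quotient.sound; assumption)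
    rcases hjk with ⟨⟨γ⟩⟩ | ⟨⟨γ⟩⟩
    · exact ⟨r, ⟨α⟩, ⟨β ≫ γ⟩⟩
    · obtain ⟨q, ⟨δ⟩, ⟨ε⟩⟩ := cospan β γ
      exact ⟨q, ⟨δ ≫ α⟩, ⟨ε⟩⟩

theorem exists_component {a : A} (x : (solution M).obj a) : ∃ s : InfSeq M a, component s = x :=
  Quotient.exists_rep x

/-- Equality of `I f [s]` and `I f' [s']` in terms of a pair of ladders. -/
theorem exists_ladders_of_map_component_eq (hM : IsSelfSimilaritySystem M) (hS : ConditionS M)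
    {a a' b : A} {f : a ⟶ b} {f' : a' ⟶ b} {s : InfSeq M a} {s' : InfSeq M a'}
    (h : (solution M).map f (component s) = (solution M).map f' (component s')) :
    ∃ (r : InfSeq M b) (α : ∀ n, r.obj n ⟶ s.obj n) (β : ∀ n, r.obj n ⟶ s'.obj n),
      r.first = lact M f (ract M s.first (α 0)) ∧ r.first = lact M f' (ract M s'.first (β 0)) ∧
      (∀ n, lact M (α n) (r.rest n) = ract M (s.rest n) (α (n + 1))) ∧
      ∀ n, lact M (β n) (r.rest n) = ract M (s'.rest n) (β (n + 1)) := by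
  obtain ⟨r, ⟨α⟩, ⟨β⟩⟩ := exists_span_of_component_eq hM hS
    (s := (InfSeq.pushforward M f).obj s) (t := (InfSeq.pushforward M f').obj s') h
  exact ⟨r, α.app, β.app, α.first.trans (lact_ract M _ _ _), β.first.trans (lact_ract M _ _ _),
    α.rest, β.rest⟩

theorem solution_isFlat (hM : IsSelfSimilaritySystem M) (hS : ConditionS M) :
    IsFlat (solution M) where
  square {a b a'} f f' x x' h := by
    obtain ⟨s, rfl⟩ := exists_component x
    obtain ⟨s', rfl⟩ := exists_component x'
    obtain ⟨r, α, β, hα, hβ, hα', hβ'⟩ := exists_ladders_of_map_component_eq hM hS h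
    obtain ⟨d, i, i', q, h1, h2, h3⟩ :=
      (hM.nondegenerate (r.obj 0)).isFlat.square _ _ _ _ (hα.symm.trans hβ)
    refine ⟨d, i, i', component ⟨r.obj, q, r.rest⟩, h1, ?_, ?_⟩
    · exact component_eq_of_hom (s := ⟨r.obj, lact M i q, r.rest⟩) ⟨α, h2, hα'⟩
    · exact component_eq_of_hom (s := ⟨r.obj, lact M i' q, r.rest⟩) ⟨β, h3, hβ'⟩
  fork {a b} f f' x h := by
    obtain ⟨s, rfl⟩ := exists_component x
    obtain ⟨r, α, β, hα, hβ, hα', hβ'⟩ := exists_ladders_of_map_component_eq hM hS h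
    -- the ladders `α, β : r → s` start from different first elements: a square `g ≫ α = g' ≫ β`
    -- merges those, and a fork on `g, g'` then makes both images in `I b` start alike
    obtain ⟨c, q, g, g', h1, h2, h3⟩ :=
      exists_ladder_square hM hS hα' hβ' r.first r.first
    obtain ⟨d, w, k, h4, h5⟩ := exists_ladder_fork hM hS h2 h3 (ract M r.first (g 0))
    have e1 : ract M (ract M s.first (α 0)) (g 0) = ract M (ract M s.first (β 0)) (g' 0) := by
      rw [← ract_comp, ← ract_comp, h1]
    let n : Elt M (d 0) a := ract M (ract M (ract M s.first (α 0)) (g 0)) (k 0)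
    have e2 : lact M f n = lact M f' n := by
      have l1 : lact M f n = ract M r.first (k 0 ≫ g 0) := by
        rw [hα, ract_comp, lact_ract, lact_ract]
      have l2 : lact M f' n = ract M r.first (k 0 ≫ g' 0) := by
        rw [hβ, ract_comp, lact_ract, lact_ract, ← e1]
      rw [l1, l2, h4]
    obtain ⟨e, i, v, h6, h7⟩ := (hM.nondegenerate (d 0)).isFlat.fork _ _ _ e2
    refine ⟨e, i, component ⟨d, v, w⟩, h6, ?_⟩
    refine component_eq_of_hom (s := ⟨d, lact M i v, w⟩)
      ⟨fun j => k j ≫ g j ≫ α j, ?_, fun j => ?_⟩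
    · refine h7.trans ?_
      rw [ract_comp, ract_comp]
    · dsimp only
      rw [lact_comp, h5, ← lact_ract, lact_comp, h2, ← lact_ract, hα', ← ract_comp, ← ract_comp,
        Category.assoc]

/-- The inverse `m ⊗ t ↦ φ_m t` of the coalgebra structure on `I`. -/
def solutionStrInv (M : CatModule A) (a : A) :
    Tensor (colPresheaf M a) (solution M) → (solution M).obj a :=
  Quot.lift (fun p => phi p.1.2 p.2) (by
    rintro _ _ ⟨g, y, x⟩
    obtain ⟨s, rfl⟩ := exists_component x
    refine component_eq_of_hom (s := (InfSeq.append (ract M y g)).obj s)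
      (t := (InfSeq.append y).obj ((InfSeq.pushforward M g).obj s))
      ⟨fun n => match n with
        | 0 => g
        | n + 1 => 𝟙 (s.obj n), rfl, fun n => ?_⟩
    match n with
    | 0 => exact (ract_id M _).symm
    | n + 1 => exact (lact_id M _).trans (ract_id M _).symm)

theorem phi_first_tail {a : A} (s : InfSeq M a) : phi s.first (component s.tail) =
    component s := by
  refine component_eq_of_hom (s := (InfSeq.append s.first).obj s.tail)
      ⟨fun n => match n with
        | 0 => 𝟙 _
        | _ + 1 => 𝟙 _, (ract_id M _).symm, fun n => ?_⟩
  match n with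
  | 0 => exact (lact_id M _).trans (ract_id M _).symm
  | n + 1 => exact (lact_id M _).trans (ract_id M _).symm

theorem solutionStr_phi {d c : A} (q : Elt M d c) (t : (solution M).obj d) :
    solutionStr M c (phi q t) = tmul (colPresheaf M c) (solution M) q t := by
  obtain ⟨s, rfl⟩ := exists_component t
  rfl

theorem solutionStrInv_solutionStr {a : A} (x : (solution M).obj a) :
    solutionStrInv M a (solutionStr M a x) = x := by
  obtain ⟨s, rfl⟩ := exists_component x
  exact phi_first_tail s

theorem solutionStr_solutionStrInv {a : A} (t : Tensor (colPresheaf M a) (solution M)) :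
    solutionStr M a (solutionStrInv M a t) = t := by
  obtain ⟨b, m, x, rfl⟩ := Tensor.exists_tmul t
  exact solutionStr_phi m x

theorem solutionStr_injective (a : A) : Function.Injective (solutionStr M a) :=
  Function.LeftInverse.injective solutionStrInv_solutionStr

theorem solutionStr_eq_iff {d c : A} (q : Elt M d c) (t : (solution M).obj d)
    (x : (solution M).obj c) :
    solutionStr M c x = tmul (colPresheaf M c) (solution M) q t ↔ x = phi q t := by
  rw [← solutionStr_phi, (solutionStr_injective c).eq_iff]

end Ladders

/-! ### Coalgebras in sets, cylinders and resolutions -/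

section SetCoalgebra

variable {A : Type u} [SmallCategory A] {M : CatModule A}

/-- A functor `V : A ⥤ Set` with a natural transformation `V ⟶ M ⊗ V`; no nondegeneracy is
required. -/
structure SetCoalgebra (M : CatModule A) where
  /-- The underlying functor. -/
  V : A ⥤ Type u
  /-- The components of the structure map. -/
  str : ∀ a, V.obj a → Tensor (colPresheaf M a) V
  naturality : ∀ {a a' : A} (f : a ⟶ a') (x : V.obj a),
    str a' (V.map f x) = tensorMap (M.flip.map f) (𝟙 V) (str a x)

/-- `(I, ι)` as a coalgebra in sets. -/
def solutionSetCoalgebra (M : CatModule A) : SetCoalgebra M where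
  V := solution M
  str := solutionStr M
  naturality f x := by
    obtain ⟨s, rfl⟩ := exists_component x
    rfl

namespace SetCoalgebra

variable (X : SetCoalgebra M)

/-- `X.Unfolds x m y` says that the structure map sends `x` to `m ⊗ y`. -/
def Unfolds {b a : A} (x : X.V.obj a) (m : Elt M b a) (y : X.V.obj b) : Prop :=
  X.str a x = tmul (colPresheaf M a) X.V m y

variable {X}

theorem exists_unfolds {a : A} (x : X.V.obj a) :
    ∃ (b : A) (m : Elt M b a) (y : X.V.obj b), X.Unfolds x m y :=
  Tensor.exists_tmul (X.str a x)

theorem Unfolds.map {b a a' : A} {x : X.V.obj a} {m : Elt M b a} {y : X.V.obj b}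
    (h : X.Unfolds x m y) (f : a ⟶ a') : X.Unfolds (X.V.map f x) (lact M f m) y := by
  unfold Unfolds at *
  rw [X.naturality, h]
  rfl

/-- If two images `g z` and `g' z` unfold, then `z` itself unfolds compatibly with both. -/
theorem exists_unfolds_of_span (hX : IsFlat X.V) {c a a' : A} {z : X.V.obj c} {g : c ⟶ a}
    {g' : c ⟶ a'} {b b' : A} {m : Elt M b a} {m' : Elt M b' a'} {w : X.V.obj b} {w' : X.V.obj b'}
    (h : X.Unfolds (X.V.map g z) m w) (h' : X.Unfolds (X.V.map g' z) m' w') :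
    ∃ (d : A) (k : d ⟶ b) (k' : d ⟶ b') (q : Elt M d c) (v : X.V.obj d),
      X.Unfolds z q v ∧ lact M g q = ract M m k ∧ lact M g' q = ract M m' k' ∧
        X.V.map k v = w ∧ X.V.map k' v = w' := by
  obtain ⟨e, q, v, hq⟩ := exists_unfolds z
  obtain ⟨d₁, i, j, u, h1, h2, h3⟩ := hX.tmul_eq_iff.1 ((hq.map g).symm.trans h)
  obtain ⟨d₂, i', j', u', h4, h5, h6⟩ := hX.tmul_eq_iff.1 ((hq.map g').symm.trans h')
  obtain ⟨d, k, k', t, h7, rfl, rfl⟩ := hX.square i i' u u' (h2.trans h5.symm)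
  replace h1 : ract M (lact M g q) i = ract M m j := h1
  replace h4 : ract M (lact M g' q) i' = ract M m' j' := h4
  refine ⟨d, k ≫ j, k' ≫ j', ract M q (k ≫ i), t, ?_, ?_, ?_, ?_, ?_⟩
  · unfold Unfolds at *
    rw [hq, ← h2, ← map_comp_apply]
    exact (tmul_glue (colPresheaf M c) X.V (k ≫ i) q t).symm
  · rw [← lact_ract, ract_comp, h1, ract_comp]
  · rw [← lact_ract, h7, ract_comp, h4, ract_comp]
  · rw [map_comp_apply, h3]
  · rw [map_comp_apply, h6]

variable (X) in
/-- The elements whose first `n` unfoldings can be taken along the first `n` module elements of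
`s`.  For the solution itself this is the basic closed set `φ_{m₁} ⋯ φ_{mₙ} (I aₙ)`. -/
def cylinder : ℕ → ∀ {a : A}, InfSeq M a → Set (X.V.obj a)
  | 0, _, _ => Set.univ
  | n + 1, _, s => {x | ∃ y ∈ cylinder n s.tail, X.Unfolds x s.first y}

theorem cylinder_succ_subset : ∀ (n : ℕ) {a : A} (s : InfSeq M a),
    X.cylinder (n + 1) s ⊆ X.cylinder n s
  | 0, _, _ => Set.subset_univ _
  | n + 1, _, s => fun _ ⟨y, hy, h⟩ => ⟨y, cylinder_succ_subset n s.tail hy, h⟩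

theorem cylinder_map {a a' : A} (f : a ⟶ a') (s : InfSeq M a) {x : X.V.obj a} {n : ℕ}
    (hx : x ∈ X.cylinder n s) :
    X.V.map f x ∈ X.cylinder n ((InfSeq.pushforward M f).obj s) := by
  cases n with
  | zero => trivial
  | succ n =>
    obtain ⟨y, hy, h⟩ := hx
    exact ⟨y, hy, h.map f⟩

variable (X) in
/-- `s` underlies a resolution of `x`: there are elements `yₙ` over the objects of `s` such that
each of `x, y₀, y₁, …` unfolds to the next along `s`. -/
def Resolves {a : A} (s : InfSeq M a) (x : X.V.obj a) : Prop :=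
  ∃ y : ∀ n, X.V.obj (s.obj n),
    X.Unfolds x s.first (y 0) ∧ ∀ n, X.Unfolds (y n) (s.rest n) (y (n + 1))

theorem Resolves.map {a a' : A} {s : InfSeq M a} {x : X.V.obj a} (h : X.Resolves s x)
    (f : a ⟶ a') : X.Resolves ((InfSeq.pushforward M f).obj s) (X.V.map f x) := by
  obtain ⟨y, h0, hy⟩ := h
  exact ⟨y, h0.map f, hy⟩

theorem Resolves.exists_tail {a : A} {s : InfSeq M a} {x : X.V.obj a} (h : X.Resolves s x) :
    ∃ y, X.Unfolds x s.first y ∧ X.Resolves s.tail y := by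
  obtain ⟨y, h0, hy⟩ := h
  exact ⟨y 0, h0, fun n => y (n + 1), hy 0, fun n => hy (n + 1)⟩

theorem Resolves.mem_cylinder {a : A} {s : InfSeq M a} {x : X.V.obj a} (h : X.Resolves s x)
    (n : ℕ) : x ∈ X.cylinder n s := by
  induction n generalizing a with
  | zero => trivial
  | succ n ih =>
    obtain ⟨y, h0, hy⟩ := h.exists_tail
    exact ⟨y, ih hy, h0⟩

variable (X) in
theorem exists_resolves {a : A} (x : X.V.obj a) : ∃ s : InfSeq M a, X.Resolves s x := by
  obtain ⟨τ, h0, hτ⟩ := exists_path (T := fun _ => Σ a : A, X.V.obj a)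
    (fun _ t t' => ∃ m : Elt M t'.1 t.1, X.Unfolds t.2 m t'.2) ⟨a, x⟩ (fun _ t => by
      obtain ⟨b, m, y, h⟩ := exists_unfolds t.2
      exact ⟨⟨b, y⟩, m, h⟩)
  obtain ⟨m₀, hm₀⟩ := h0 ▸ hτ 0
  choose m hm using hτ
  exact ⟨⟨fun n => (τ (n + 1)).1, m₀, fun n => m (n + 1)⟩, fun n => (τ (n + 1)).2, hm₀,
    fun n => hm (n + 1)⟩

/-- Any two resolutions of an element are joined by a span of resolutions, so the component of a
resolution is well defined. -/
theorem Resolves.component_eq (hX : IsFlat X.V) {a : A} {s s' : InfSeq M a} {x : X.V.obj a}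
    (h : X.Resolves s x) (h' : X.Resolves s' x) : component s = component s' := by
  obtain ⟨y, h0, hy⟩ := h
  obtain ⟨y', h0', hy'⟩ := h'
  let T (k : ℕ) := {t : Σ c : A, X.V.obj c × (c ⟶ s.obj k) × (c ⟶ s'.obj k) //
    X.V.map t.2.2.1 t.2.1 = y k ∧ X.V.map t.2.2.2 t.2.1 = y' k}
  have hx : X.V.map (𝟙 a) x = x := by simp
  obtain ⟨c, g, g', q₀, z, -, h1, h2, h3, h4⟩ :=
    exists_unfolds_of_span hX (hx.symm ▸ h0) (hx.symm ▸ h0')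
  obtain ⟨τ, hτ₀, hτ⟩ := exists_path (T := T)
    (fun k t t' => ∃ q : Elt M t'.1.1 t.1.1, lact M t.1.2.2.1 q = ract M (s.rest k) t'.1.2.2.1 ∧
      lact M t.1.2.2.2 q = ract M (s'.rest k) t'.1.2.2.2) ⟨⟨c, z, g, g'⟩, h3, h4⟩ (by
      rintro k ⟨⟨c, z, g, g'⟩, hz, hz'⟩
      obtain ⟨d, i, i', q, v, -, h1, h2, h3, h4⟩ := exists_unfolds_of_span hX
        (hz.symm ▸ hy k : X.Unfolds (X.V.map g z) _ _)
        (hz'.symm ▸ hy' k : X.Unfolds (X.V.map g' z) _ _)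
      exact ⟨⟨⟨d, v, i, i'⟩, h3, h4⟩, q, h1, h2⟩)
  choose q hq hq' using hτ
  have hf : ∃ q₀ : Elt M (τ 0).1.1 a, q₀ = ract M s.first (τ 0).1.2.2.1 ∧
      q₀ = ract M s'.first (τ 0).1.2.2.2 := by
    rw [hτ₀]
    rw [lact_id] at h1 h2
    exact ⟨q₀, h1, h2⟩
  obtain ⟨q₁, hq₁, hq₁'⟩ := hf
  let r : InfSeq M a := ⟨fun n => (τ n).1.1, q₁, q⟩
  exact (component_eq_of_hom (s := r) ⟨fun n => (τ n).1.2.2.1, hq₁, hq⟩).symm.trans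
    (component_eq_of_hom (s := r) ⟨fun n => (τ n).1.2.2.2, hq₁', hq'⟩)

variable (X) in
/-- The map to the solution, sending an element to the component of any of its resolutions. -/
noncomputable def toSolution {a : A} (x : X.V.obj a) : (solution M).obj a :=
  component (X.exists_resolves x).choose

theorem Resolves.toSolution_eq (hX : IsFlat X.V) {a : A} {s : InfSeq M a} {x : X.V.obj a}
    (h : X.Resolves s x) : X.toSolution x = component s :=
  (X.exists_resolves x).choose_spec.component_eq hX h

theorem toSolution_map (hX : IsFlat X.V) {a a' : A} (f : a ⟶ a') (x : X.V.obj a) :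
    X.toSolution (X.V.map f x) = (solution M).map f (X.toSolution x) := by
  obtain ⟨s, hs⟩ := X.exists_resolves x
  rw [(hs.map f).toSolution_eq hX, hs.toSolution_eq hX]
  rfl

/-- The natural transformation with components `SetCoalgebra.toSolution`. -/
noncomputable def toSolutionHom (hX : IsFlat X.V) : X.V ⟶ solution M where
  app a := ↾(X.toSolution (a := a))
  naturality a a' f := by
    ext x
    exact toSolution_map hX f x

theorem solutionStr_toSolution (hX : IsFlat X.V) {a : A} (x : X.V.obj a) :
    solutionStr M a (X.toSolution x) =
      tensorMap (𝟙 (colPresheaf M a)) (toSolutionHom hX) (X.str a x) := by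
  obtain ⟨s, hs⟩ := X.exists_resolves x
  obtain ⟨y, h0, hy⟩ := hs.exists_tail
  rw [hs.toSolution_eq hX, h0, tensorMap_tmul]
  change tmul (colPresheaf M a) (solution M) s.first (component s.tail) =
    tmul (colPresheaf M a) (solution M) s.first (X.toSolution y)
  rw [hy.toSolution_eq hX]

/-- Maps of coalgebras preserve cylinders. -/
theorem map_mem_cylinder {X Y : SetCoalgebra M} (β : X.V ⟶ Y.V)
    (hβ : ∀ (a : A) (x : X.V.obj a), Y.str a (β.app a x) =
      tensorMap (𝟙 (colPresheaf M a)) β (X.str a x))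
    {n : ℕ} {a : A} {s : InfSeq M a} {x : X.V.obj a} (hx : x ∈ X.cylinder n s) :
    β.app a x ∈ Y.cylinder n s := by
  induction n generalizing a with
  | zero => trivial
  | succ n ih =>
    obtain ⟨y, hy, h⟩ := hx
    refine ⟨β.app _ y, ih hy, ?_⟩
    unfold Unfolds at *
    rw [hβ, h]
    rfl

/-- Along an ultrafilter, unfoldings can be chosen uniformly, by finiteness of `M`. -/
theorem exists_eventually_mem_cylinder (hM : M.IsFinite) {ι : Type*} (𝓤 : Ultrafilter ι) {a : A}
    (x : ι → X.V.obj a) :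
    ∃ s : InfSeq M a, ∀ n, ∀ᶠ i in (𝓤 : Filter ι), x i ∈ X.cylinder n s := by
  have key : ∀ (n : ℕ) {a : A} (s : InfSeq M a) (x : ι → X.V.obj a)
      (y : ∀ k, ι → X.V.obj (s.obj k)), (∀ᶠ i in (𝓤 : Filter ι), X.Unfolds (x i) s.first (y 0 i)) →
      (∀ k, ∀ᶠ i in (𝓤 : Filter ι), X.Unfolds (y k i) (s.rest k) (y (k + 1) i)) →
      ∀ᶠ i in (𝓤 : Filter ι), x i ∈ X.cylinder n s := by
    intro n
    induction n with
    | zero => exact fun _ _ _ _ _ => Filter.Eventually.of_forall fun _ => trivial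
    | succ n ih =>
      intro a s x y h0 hy
      filter_upwards [h0, ih s.tail (y 0) (fun k => y (k + 1)) (hy 0) (fun k => hy (k + 1))]
        with i h1 h2
      exact ⟨_, h2, h1⟩
  obtain ⟨τ, hτ₀, hτ⟩ := exists_path (T := fun _ => Σ c : A, ι → X.V.obj c)
    (fun _ t t' => ∃ q : Elt M t'.1 t.1, ∀ᶠ i in (𝓤 : Filter ι), X.Unfolds (t.2 i) q (t'.2 i))
    ⟨a, x⟩ (by
      rintro - ⟨c, y⟩
      have := hM.finite_elt c
      obtain ⟨⟨d, q⟩, hq⟩ := (Ultrafilter.eventually_exists_iff (f := 𝓤)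
        (P := fun (q : Σ d : A, Elt M d c) i => ∃ z, X.Unfolds (y i) q.2 z)).1
        (Filter.Eventually.of_forall fun i => by
          obtain ⟨d, q, z, h⟩ := exists_unfolds (y i)
          exact ⟨⟨d, q⟩, z, h⟩)
      obtain ⟨-, z₀, -⟩ := hq.exists
      have : Nonempty (X.V.obj d) := ⟨z₀⟩
      have hq' : ∃ y' : ι → X.V.obj d, ∀ i, (∃ z, X.Unfolds (y i) q z) →
          X.Unfolds (y i) q (y' i) := by
        choose! y' hy' using fun i (h : ∃ z, X.Unfolds (y i) q z) => h
        exact ⟨y', hy'⟩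
      obtain ⟨y', hy'⟩ := hq'
      exact ⟨⟨d, y'⟩, q, hq.mono hy'⟩)
  obtain ⟨m₀, hm₀⟩ := hτ₀ ▸ hτ 0
  choose m hm using hτ
  exact ⟨⟨fun n => (τ (n + 1)).1, m₀, fun n => m (n + 1)⟩, fun n =>
    key n _ x (fun k => (τ (k + 1)).2) hm₀ (fun k => hm (k + 1))⟩

end SetCoalgebra

end SetCoalgebra

/-! ### Points of the solution are determined by the cylinders containing them -/

section Solution

variable {A : Type u} [SmallCategory A] {M : CatModule A}

/-- The sequence `⋯ ⇸ aₖ₊₂ ⇸ aₖ₊₁` obtained by discarding the first `k + 1` module elements. -/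
def InfSeq.drop : ∀ (k : ℕ) {a : A} (s : InfSeq M a), InfSeq M (s.obj k)
  | 0, _, s => s.tail
  | k + 1, _, s => InfSeq.drop k s.tail

theorem SetCoalgebra.mem_cylinder_drop (X : SetCoalgebra M) {n : ℕ} :
    ∀ {k : ℕ} {a : A} {s : InfSeq M a} {x : X.V.obj (s.obj k)},
    x ∈ X.cylinder (n + 1) (s.drop k) →
      ∃ y ∈ X.cylinder n (s.drop (k + 1)), X.Unfolds x (s.rest k) y
  | 0, _, _, _ => id
  | k + 1, _, s, _ => X.mem_cylinder_drop (k := k) (s := s.tail)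

theorem solution_resolves {a : A} (s : InfSeq M a) :
    (solutionSetCoalgebra M).Resolves s (component s) := by
  have key : ∀ (k : ℕ) {a : A} (s : InfSeq M a), (solutionSetCoalgebra M).Unfolds
      (component (s.drop k)) (s.rest k) (component (s.drop (k + 1))) := by
    intro k
    induction k with
    | zero => exact fun s => rfl
    | succ k ih => exact fun s => ih s.tail
  exact ⟨fun k => component (s.drop k), rfl, fun k => key k s⟩

theorem component_mem_cylinder {a : A} (s : InfSeq M a) (n : ℕ) :
    component s ∈ (solutionSetCoalgebra M).cylinder n s :=
  (solution_resolves s).mem_cylinder n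

/-- If the cylinders of `s` and `t` meet at every length, then `[s] = [t]`: a common point of the
cylinders of length `n` yields a span of length `n` between `s` and `t`, and these assemble by
König's lemma. -/
theorem component_eq_of_cylinder_inter (hM : IsSelfSimilaritySystem M) (hS : ConditionS M) {a : A}
    {s t : InfSeq M a} (h : ∀ n, ((solutionSetCoalgebra M).cylinder n s ∩
      (solutionSetCoalgebra M).cylinder n t).Nonempty) : component s = component t := by
  set X := solutionSetCoalgebra M with hXdef
  have hX : IsFlat X.V := solution_isFlat hM hS
  let T (k : ℕ) := Σ c : A, (c ⟶ s.obj k) × (c ⟶ t.obj k)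
  have hfin (k : ℕ) : Finite (T k) := by
    cases k with
    | zero => exact hM.finite.finite_span s.first t.first
    | succ k => exact hM.finite.finite_span (s.rest k) (t.rest k)
  obtain ⟨τ, h0, hτ⟩ := exists_path_of_finite (T := T)
    (fun k τ τ' => ∃ q : Elt M τ'.1 τ.1, lact M τ.2.1 q = ract M (s.rest k) τ'.2.1 ∧
      lact M τ.2.2 q = ract M (t.rest k) τ'.2.2)
    (fun k n τ => ∃ z : X.V.obj τ.1, X.V.map τ.2.1 z ∈ X.cylinder n (s.drop k) ∧
      X.V.map τ.2.2 z ∈ X.cylinder n (t.drop k))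
    (fun τ => ract M s.first τ.2.1 = ract M t.first τ.2.2)
    (fun k n τ ⟨z, h1, h2⟩ => ⟨z, SetCoalgebra.cylinder_succ_subset _ _ h1,
      SetCoalgebra.cylinder_succ_subset _ _ h2⟩)
    (by
      rintro k n ⟨c, g, g'⟩ ⟨z, h1, h2⟩
      obtain ⟨w, hw, h1⟩ := X.mem_cylinder_drop h1
      obtain ⟨w', hw', h2⟩ := X.mem_cylinder_drop h2
      obtain ⟨d, i, i', q, v, -, h3, h4, rfl, rfl⟩ :=
        SetCoalgebra.exists_unfolds_of_span hX h1 h2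
      exact ⟨⟨d, i, i'⟩, ⟨q, h3, h4⟩, v, hw, hw'⟩)
    (fun n => by
      obtain ⟨x, ⟨w, hw, h1⟩, w', hw', h2⟩ := h (n + 1)
      have hx : X.V.map (𝟙 a) x = x := by simp
      obtain ⟨d, i, i', q, v, -, h3, h4, rfl, rfl⟩ := SetCoalgebra.exists_unfolds_of_span hX
        (hx.symm ▸ h1 : X.Unfolds (X.V.map (𝟙 a) x) _ _)
        (hx.symm ▸ h2 : X.Unfolds (X.V.map (𝟙 a) x) _ _)
      exact ⟨⟨d, i, i'⟩, h3.symm.trans h4, v, hw, hw'⟩)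
  choose q hq hq' using hτ
  let r : InfSeq M a := ⟨fun n => (τ n).1, ract M s.first (τ 0).2.1, q⟩
  exact (component_eq_of_hom (s := r) ⟨fun n => (τ n).2.1, rfl, hq⟩).symm.trans
    (component_eq_of_hom (s := r) ⟨fun n => (τ n).2.2, h0, hq'⟩)

theorem eq_component_of_mem_cylinder (hM : IsSelfSimilaritySystem M) (hS : ConditionS M) {a : A}
    {s : InfSeq M a} {x : (solution M).obj a}
    (h : ∀ n, x ∈ (solutionSetCoalgebra M).cylinder n s) : x = component s := by
  obtain ⟨t, rfl⟩ := exists_component x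
  exact component_eq_of_cylinder_inter hM hS fun n => ⟨_, component_mem_cylinder t n, h n⟩

/-! ### The topology of the solution -/

theorem exists_finSeq_range_eq_cylinder (n : ℕ) {a : A} (s : InfSeq M a) :
    ∃ (b : A) (p : FinSeq M b a), (solutionSetCoalgebra M).cylinder n s = Set.range p.phi := by
  induction n generalizing a with
  | zero => exact ⟨a, .nil, Set.range_id.symm⟩
  | succ n ih =>
    obtain ⟨b, p, hp⟩ := ih s.tail
    refine ⟨b, p.snoc s.first, ?_⟩
    ext x
    constructor
    · rintro ⟨y, hy, h⟩
      rw [hp] at hy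
      obtain ⟨z, rfl⟩ := hy
      exact ⟨z, ((solutionStr_eq_iff _ _ _).1 h).symm⟩
    · rintro ⟨z, rfl⟩
      exact ⟨p.phi z, hp ▸ ⟨z, rfl⟩, solutionStr_phi _ _⟩

theorem isClosed_range_phi {b a : A} (p : FinSeq M b a) : IsClosed (Set.range p.phi) :=
  ⟨TopologicalSpace.isOpen_generateFrom_of_mem ⟨b, p, rfl⟩⟩

theorem isClosed_solution_cylinder (n : ℕ) {a : A} (s : InfSeq M a) :
    IsClosed (X := (solution M).obj a) ((solutionSetCoalgebra M).cylinder n s) := by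
  obtain ⟨b, p, hp⟩ := exists_finSeq_range_eq_cylinder n s
  exact hp ▸ isClosed_range_phi p

/-- The concatenation of a finite sequence with an infinite one. -/
def FinSeq.concat {b : A} : {a : A} → FinSeq M b a → InfSeq M b → InfSeq M a
  | _, .nil, s => s
  | _, .snoc p q, s => (InfSeq.append q).obj (p.concat s)

theorem FinSeq.phi_component {b a : A} (p : FinSeq M b a) (s : InfSeq M b) :
    p.phi (component s) = component (p.concat s) := by
  induction p with
  | nil => rfl
  | snoc p q ih =>
    change SelfSim.phi q (p.phi (component s)) = _
    rw [ih]
    rfl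

theorem FinSeq.phi_mem_cylinder {b a : A} (p : FinSeq M b a) {s : InfSeq M b} {n : ℕ}
    {x : (solution M).obj b} (hx : x ∈ (solutionSetCoalgebra M).cylinder n s) :
    p.phi x ∈ (solutionSetCoalgebra M).cylinder n (p.concat s) := by
  induction p with
  | nil => exact hx
  | snoc p q ih =>
    exact SetCoalgebra.cylinder_succ_subset n _ ⟨p.phi x, ih, solutionStr_phi _ _⟩

/-- An ultrafilter containing every cylinder of `s` converges to `[s]`. -/
theorem ultrafilter_le_nhds_component (hM : IsSelfSimilaritySystem M) (hS : ConditionS M) {a : A}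
    {s : InfSeq M a} (𝓤 : Ultrafilter ((solution M).obj a))
    (h : ∀ n, (solutionSetCoalgebra M).cylinder n s ∈ 𝓤) : ↑𝓤 ≤ nhds (component s) := by
  refine TopologicalSpace.tendsto_nhds_generateFrom_iff.2 ?_
  rintro _ ⟨b, p, rfl⟩ hs
  refine (Ultrafilter.compl_mem_iff_notMem (f := 𝓤)).2 fun hp => hs ?_
  -- lift `𝓤` along `φ_p` and follow the lifted points to a sequence `t` over `b`
  obtain ⟨-, z₀, -⟩ := 𝓤.nonempty_of_mem hp
  have : Nonempty ((solution M).obj b) := ⟨z₀⟩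
  obtain ⟨y, hy⟩ : ∃ y : (solution M).obj a → (solution M).obj b,
      ∀ x ∈ Set.range p.phi, p.phi (y x) = x :=
    ⟨Function.invFun p.phi, fun _ hx => Function.invFun_eq hx⟩
  obtain ⟨t, ht⟩ := SetCoalgebra.exists_eventually_mem_cylinder (X := solutionSetCoalgebra M)
    hM.finite 𝓤 y
  refine ⟨component t, ?_⟩
  rw [FinSeq.phi_component]
  refine component_eq_of_cylinder_inter hM hS fun n => ?_
  obtain ⟨x, ⟨h1, h2⟩, h3⟩ := Filter.nonempty_of_mem
    (Filter.inter_mem (Filter.inter_mem (ht n) hp) (Ultrafilter.mem_coe.2 (h n)))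
  refine ⟨x, ?_, h3⟩
  have := p.phi_mem_cylinder h1
  rwa [hy x h2] at this

theorem exists_cylinder_mem_ultrafilter (hM : IsSelfSimilaritySystem M) {a : A}
    (𝓤 : Ultrafilter ((solution M).obj a)) :
    ∃ s : InfSeq M a, ∀ n, (solutionSetCoalgebra M).cylinder n s ∈ 𝓤 :=
  SetCoalgebra.exists_eventually_mem_cylinder (X := solutionSetCoalgebra M) hM.finite 𝓤 id

theorem compactSpace_solution (hM : IsSelfSimilaritySystem M) (hS : ConditionS M) (a : A) :
    CompactSpace ((solution M).obj a) := by
  refine ⟨isCompact_iff_ultrafilter_le_nhds.2 fun 𝓤 _ => ?_⟩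
  obtain ⟨s, hs⟩ := exists_cylinder_mem_ultrafilter hM 𝓤
  exact ⟨_, trivial, ultrafilter_le_nhds_component hM hS 𝓤 hs⟩

theorem eq_component_of_ultrafilter_le (hM : IsSelfSimilaritySystem M) (hS : ConditionS M) {a : A}
    {s : InfSeq M a} {𝓤 : Ultrafilter ((solution M).obj a)} {x : (solution M).obj a}
    (hx : ↑𝓤 ≤ nhds x) (h : ∀ n, (solutionSetCoalgebra M).cylinder n s ∈ 𝓤) : x = component s :=
  eq_component_of_mem_cylinder hM hS fun n =>
    isClosed_iff_ultrafilter.1 (isClosed_solution_cylinder n s) x 𝓤 hx (h n)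

theorem t2Space_solution (hM : IsSelfSimilaritySystem M) (hS : ConditionS M) (a : A) :
    T2Space ((solution M).obj a) := by
  refine t2_iff_ultrafilter.2 fun {x y} 𝓤 hx hy => ?_
  obtain ⟨s, hs⟩ := exists_cylinder_mem_ultrafilter hM 𝓤
  rw [eq_component_of_ultrafilter_le hM hS hx hs, eq_component_of_ultrafilter_le hM hS hy hs]

theorem continuous_solution_map (hM : IsSelfSimilaritySystem M) (hS : ConditionS M) {a a' : A}
    (f : a ⟶ a') : Continuous ((solution M).map f) := by
  refine continuous_iff_ultrafilter.2 fun x 𝓤 hx => ?_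
  obtain ⟨s, hs⟩ := exists_cylinder_mem_ultrafilter hM 𝓤
  rw [eq_component_of_ultrafilter_le hM hS hx hs]
  exact ultrafilter_le_nhds_component hM hS (s := (InfSeq.pushforward M f).obj s)
    (𝓤.map ((solution M).map f)) fun n => Ultrafilter.mem_map.2 <|
      Filter.mem_of_superset (Ultrafilter.mem_coe.2 (hs n)) fun _ hx =>
        SetCoalgebra.cylinder_map (X := solutionSetCoalgebra M) f s hx

theorem continuous_phi (hM : IsSelfSimilaritySystem M) (hS : ConditionS M) {d c : A}
    (q : Elt M d c) : Continuous (phi q) := by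
  refine continuous_iff_ultrafilter.2 fun x 𝓤 hx => ?_
  obtain ⟨s, hs⟩ := exists_cylinder_mem_ultrafilter hM 𝓤
  rw [eq_component_of_ultrafilter_le hM hS hx hs]
  exact ultrafilter_le_nhds_component hM hS (s := (InfSeq.append q).obj s)
    (𝓤.map (phi q)) fun n => Ultrafilter.mem_map.2 <|
      Filter.mem_of_superset (Ultrafilter.mem_coe.2 (hs n)) fun _ hx =>
        ((FinSeq.nil (M := M)).snoc q).phi_mem_cylinder hx

/-- `ι_a` is inverse to the continuous bijection `m ⊗ t ↦ φ_m t` from a compact space (a quotient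
of a finite sum of compact spaces) to a Hausdorff one. -/
theorem continuous_solutionStr (hM : IsSelfSimilaritySystem M) (hS : ConditionS M) (a : A) :
    Continuous (solutionStr M a) := by
  have := compactSpace_solution hM hS
  have := t2Space_solution hM hS
  have : Finite (Σ b : A, (colPresheaf M a).obj (op b)) := hM.finite.finite_elt a
  have : CompactSpace (PreTensor (colPresheaf M a) (solution M)) :=
    inferInstanceAs (CompactSpace (Σ p : (Σ b : A, (colPresheaf M a).obj (op b)),
      (solution M).obj p.1))
  have : CompactSpace (Tensor (colPresheaf M a) (solution M)) :=
    inferInstanceAs (CompactSpace (Quot _))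
  have hc : Continuous (solutionStrInv M a) :=
    continuous_quot_lift _ (continuous_sigma fun p => continuous_phi hM hS p.2)
  let e : Tensor (colPresheaf M a) (solution M) ≃ (solution M).obj a :=
    ⟨solutionStrInv M a, solutionStr M a, solutionStr_solutionStrInv, solutionStrInv_solutionStr⟩
  exact Continuous.continuous_symm_of_equiv_compact_to_t2 (f := e) hc

end Solution

/-! ### Coalgebras in spaces -/

section TopCoalgebra

variable {A : Type u} [SmallCategory A] {M : CatModule A}

/-- The coalgebra in sets underlying a coalgebra in spaces. -/
def underlying (X : Endofunctor.Coalgebra (moduleTensorFunctor M)) : SetCoalgebra M where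
  V := X.V ⋙ forget TopCat.{u}
  str a := X.str.app a
  naturality f x := ConcreteCategory.congr_hom (X.str.naturality f) x

/-- If the maps `V f` are continuous and closed then so is `m ⊗ -`: by flatness, the saturation of
a closed set is a finite union of sets of the form `V g' (V g)⁻¹ C`. -/
theorem isClosedMap_tmul (hM : M.IsFinite) {V : A ⥤ Type u} (hV : IsFlat V)
    [∀ a, TopologicalSpace (V.obj a)] (hcont : ∀ {a a' : A} (f : a ⟶ a'), Continuous (V.map f))
    (hclosed : ∀ {a a' : A} (f : a ⟶ a'), IsClosedMap (V.map f)) {b a : A} (m : Elt M b a) :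
    IsClosedMap (tmul (colPresheaf M a) V (a := b) m) := by
  intro C hC
  refine isClosed_coinduced.2 (isClosed_sigma_iff.2 ?_)
  rintro ⟨b', m'⟩
  have := hM.finite_span m m'
  have e : {x : V.obj b' | tmul (colPresheaf M a) V (a := b') m' x ∈
        tmul (colPresheaf M a) V (a := b) m '' C} =
      ⋃ t : {t : Σ c : A, (c ⟶ b) × (c ⟶ b') // ract M m t.2.1 = ract M m' t.2.2},
        V.map t.1.2.2 '' (V.map t.1.2.1 ⁻¹' C) := by
    ext x
    simp only [Set.mem_ofPred_eq, Set.mem_preimage, Set.mem_image, Set.mem_iUnion, Subtype.exists]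
    constructor
    · rintro ⟨y, hy, h⟩
      obtain ⟨c, g, g', z, h1, h2, h3⟩ := (hV.tmul_eq_iff (y' := m') (x' := x)).1 h
      exact ⟨⟨c, g, g'⟩, h1, z, h2 ▸ hy, h3⟩
    · rintro ⟨⟨c, g, g'⟩, h1, z, hz, h3⟩
      exact ⟨_, hz, (hV.tmul_eq_iff (y' := m') (x' := x)).2 ⟨c, g, g', z, h1, rfl, h3⟩⟩
  have h : IsClosed {x : V.obj b' | tmul (colPresheaf M a) V (a := b') m' x ∈
      tmul (colPresheaf M a) V (a := b) m '' C} := by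
    rw [e]
    exact isClosed_iUnion_of_finite fun t => hclosed _ _ (hC.preimage (hcont _))
  exact h

variable {X : Endofunctor.Coalgebra (moduleTensorFunctor M)}

theorem isClosed_cylinder (hM : M.IsFinite) (hX : NondegenerateTop X.V) (n : ℕ) {a : A}
    (s : InfSeq M a) : IsClosed (X := X.V.obj a) ((underlying X).cylinder n s) := by
  induction n generalizing a with
  | zero => exact isClosed_univ
  | succ n ih =>
    have h := isClosedMap_tmul hM hX.1.isFlat (fun f => (X.V.map f).hom.continuous)
      (fun f => hX.2 f) s.first _ (ih s.tail)
    have e : (underlying X).cylinder (n + 1) s = X.str.app a ⁻¹'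
        (tmul (colPresheaf M a) (X.V ⋙ forget TopCat.{u}) (a := s.obj 0) s.first ''
          (underlying X).cylinder n s.tail) := by
      ext x
      exact ⟨fun ⟨y, hy, h⟩ => ⟨y, hy, h.symm⟩, fun ⟨y, hy, h⟩ => ⟨y, hy, h.symm⟩⟩
    rw [e]
    exact IsClosed.preimage (X.str.app a).hom.continuous h

theorem continuous_toSolution (hM : IsSelfSimilaritySystem M) (hS : ConditionS M)
    (hX : NondegenerateTop X.V) (a : A) :
    Continuous (X := X.V.obj a) ((underlying X).toSolution (a := a)) := by
  have hflat : IsFlat (underlying X).V := hX.1.isFlat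
  have hmem {a : A} {s : InfSeq M a} {n : ℕ} {x : X.V.obj a}
      (hx : x ∈ (underlying X).cylinder n s) :
      (underlying X).toSolution x ∈ (solutionSetCoalgebra M).cylinder n s :=
    SetCoalgebra.map_mem_cylinder (Y := solutionSetCoalgebra M) (SetCoalgebra.toSolutionHom hflat)
      (fun _ x => SetCoalgebra.solutionStr_toSolution hflat x) hx
  refine continuous_iff_ultrafilter.2 fun x 𝓤 hx => ?_
  obtain ⟨s, hs⟩ := SetCoalgebra.exists_eventually_mem_cylinder (X := underlying X) hM.finite 𝓤 id
  have hxs : (underlying X).toSolution x = component s :=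
    eq_component_of_mem_cylinder hM hS fun n =>
      hmem (isClosed_iff_ultrafilter.1 (isClosed_cylinder hM.finite hX n s) x 𝓤 hx (hs n))
  rw [hxs]
  exact ultrafilter_le_nhds_component hM hS (𝓤.map _) fun n => Ultrafilter.mem_map.2 <|
    Filter.mem_of_superset (hs n) fun _ hx => hmem hx

theorem nondegenerateTop_solution (hM : IsSelfSimilaritySystem M) (hS : ConditionS M)
    (hI : ∀ ⦃a a' : A⦄ (f : a ⟶ a'), Continuous ((solution M).map f)) :
    NondegenerateTop (solutionTop M hI) := by
  refine ⟨(solution_isFlat hM hS).nondegenerate, fun a a' f => ?_⟩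
  have := compactSpace_solution hM hS a
  have := t2Space_solution hM hS a'
  exact (hI f).isClosedMap

/-- The map of coalgebras from `X` to the solution. -/
noncomputable def toSolutionCoalgebra (hM : IsSelfSimilaritySystem M) (hS : ConditionS M)
    (hI : ∀ ⦃a a' : A⦄ (f : a ⟶ a'), Continuous ((solution M).map f))
    (hι : ∀ a : A, Continuous (solutionStr M a)) (hX : NondegenerateTop X.V) :
    X ⟶ solutionCoalgebra M hI hι where
  f :=
    { app := fun a => TopCat.ofHom
        ⟨(underlying X).toSolution (a := a), continuous_toSolution hM hS hX a⟩
      naturality := fun a a' f => by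
        ext x
        exact SetCoalgebra.toSolution_map (X := underlying X) hX.1.isFlat f x }
  h := by
    ext a x
    exact (SetCoalgebra.solutionStr_toSolution (X := underlying X) hX.1.isFlat x).symm

/-- A map of coalgebras into the solution sends `x` to a point lying in all the cylinders of any
resolution of `x`, and there is only one such point. -/
theorem hom_solutionCoalgebra_ext (hM : IsSelfSimilaritySystem M) (hS : ConditionS M)
    {hI : ∀ ⦃a a' : A⦄ (f : a ⟶ a'), Continuous ((solution M).map f)}
    {hι : ∀ a : A, Continuous (solutionStr M a)} (β γ : X ⟶ solutionCoalgebra M hI hι) :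
    β = γ := by
  have key (β : X ⟶ solutionCoalgebra M hI hι) {a : A} (x : X.V.obj a) {s : InfSeq M a}
      (hs : (underlying X).Resolves s x) : β.f.app a x = component s :=
    eq_component_of_mem_cylinder hM hS fun n =>
      SetCoalgebra.map_mem_cylinder (X := underlying X) (Y := solutionSetCoalgebra M)
        (Functor.whiskerRight β.f (forget TopCat.{u}))
        (fun a x => (ConcreteCategory.congr_hom (NatTrans.congr_app β.h a) x).symm)
        (hs.mem_cylinder n)
  refine Endofunctor.Coalgebra.Hom.ext ?_
  ext a x
  obtain ⟨s, hs⟩ := (underlying X).exists_resolves x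
  exact (key β x hs).trans (key γ x hs).symm

end TopCoalgebra

end SelfSim

theorem theorem6 {A : Type u} [SmallCategory A] (M : SelfSim.CatModule A)
    (hM : SelfSim.IsSelfSimilaritySystem M) (hS : SelfSim.ConditionS M) :
    (∀ a : A, CompactSpace ((SelfSim.solution M).obj a)) ∧
    (∀ a : A, T2Space ((SelfSim.solution M).obj a)) ∧
    (∀ ⦃a a' : A⦄ (f : a ⟶ a'), IsClosedMap ((SelfSim.solution M).map f)) ∧
    ∃ (hI : ∀ ⦃a a' : A⦄ (f : a ⟶ a'), Continuous ((SelfSim.solution M).map f))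
      (hι : ∀ a : A, Continuous (SelfSim.solutionStr M a))
      (hnd : SelfSim.NondegenerateTop (SelfSim.solutionTop M hI)),
      Nonempty (IsTerminal
        (⟨SelfSim.solutionCoalgebra M hI hι, hnd⟩ : SelfSim.TopCoalgebra M)) := by
  have hI : ∀ ⦃a a' : A⦄ (f : a ⟶ a'), Continuous ((SelfSim.solution M).map f) :=
    fun a a' f => SelfSim.continuous_solution_map hM hS f
  have hι := SelfSim.continuous_solutionStr hM hS
  have hnd := SelfSim.nondegenerateTop_solution hM hS hI
  exact ⟨SelfSim.compactSpace_solution hM hS, SelfSim.t2Space_solution hM hS, hnd.2, hI, hι, hnd,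
    ⟨IsTerminal.ofUniqueHom
      (fun X => ObjectProperty.homMk (SelfSim.toSolutionCoalgebra hM hS hI hι X.property))
      (fun X β => ObjectProperty.hom_ext _
        (SelfSim.hom_solutionCoalgebra_ext hM hS β.hom _))⟩⟩
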